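/- Consider $M$ secondary users (SUs) and $K$ frequency bands, each occupied by one primary user (PU). A channel state is $\mathbf h=(a_k,\,h_{k,1}^m,\,h_{k,2}^m)_{1\le k\le K,\,1\le m\le M}$, where $a_k\in\{0,1\}$ indicates whether the PU of band $k$ is active, and $h_{k,1}^m\ge 0$ and $h_{k,2}^m\ge 0$ are the power gains from SU $m$ to the PU of band $k$ and to the access point in band $k$. Let $\mathbf h$ be random, with a non-atomic law. Put $r_2(x)=\log_2(1+x)$ and $r_{k,1}(x)=\log_2\bigl(1+\frac{\gamma_k}{1+x}\bigr)$ with $\gamma_k\ge 0$. Let $\beta^m>0$ be weights, let $\check p_2^m,\check p_{k,1},\check r_{k,1}\in\mathbb R$ be long-term limits, and let $\check p_{k,2}^m(\mathbf h)\ge 0$ be measurable peak-power limits such that the expectations at peak power $\mathbb E[\check p_{k,2}^m(\mathbf h)]$, $\mathbb E[a_k h_{k,1}^m\check p_{k,2}^m(\mathbf h)]$ and $\mathbb E[r_2(h_{k,2}^m\check p_{k,2}^m(\mathbf h))]$ are finite. A policy $z$ consists of measurable functions $w_k^m(\mathbf h)$, $0\le m\le M$, and $p_k^m(\mathbf h)$,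 $1\le m\le M$; the index $m=0$ is a virtual user with zero power and zero rate, $p_k^0=0$. It is short-term admissible, written $z\in\mathcal Z$, if for all $\mathbf h$, $k$ and $m$ $$w_k^m(\mathbf h)\in\{0,1\},\qquad \sum_{m=0}^M w_k^m(\mathbf h)=1,\qquad 0\le p_k^m(\mathbf h)\le\check p_{k,2}^m(\mathbf h).$$ The primal problem is to maximize the weighted ergodic sum-capacity $$\bar c_2(z)=\sum_{k=1}^K\sum_{m=1}^M\mathbb E\bigl[\beta^m w_k^m(\mathbf h)\,r_2(h_{k,2}^m p_k^m(\mathbf h))\bigr]$$ over all $z\in\mathcal Z$ that satisfy the long-term constraints $$\mathbb E\Bigl[\sum_k w_k^m p_k^m\Bigr]\le\check p_2^m\ \ \forall m,\qquad \mathbb E\Bigl[\sum_{m=1}^M w_k^m h_{k,1}^m p_k^m\,\Big|\,a_k=1\Bigr]\le\check p_{k,1}\ \ \forall k,\qquad \mathbb E\Bigl[\sum_{m=0}^M w_k^m r_{k,1}(h_{k,1}^m p_k^m)\,\Big|\,a_k=1\Bigr]\ge\check r_{k,1}\ \ \forall k,$$ where $h_{k,1}^0p_k^0=0$, and the last two constraints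 are void for those $k$ with $\Pr(a_k=1)=0$. For multipliers $\pi\in\mathbb R_{\ge0}^M$ and $\theta,\rho\in\mathbb R_{\ge0}^K$ let $$\mathcal L(z;\pi,\theta,\rho)=\mathbb E\Bigl[\sum_{k,m}\beta^m w_k^m r_2(h_{k,2}^m p_k^m)-\sum_m\pi^m\Bigl(\sum_k w_k^m p_k^m-\check p_2^m\Bigr)-\sum_k\theta_k a_k\Bigl(\sum_m w_k^m h_{k,1}^m p_k^m-\check p_{k,1}\Bigr)+\sum_k\rho_k a_k\Bigl(\sum_m w_k^m r_{k,1}(h_{k,1}^m p_k^m)-\check r_{k,1}\Bigr)\Bigr].$$ Then the problem has zero duality gap: $$\sup\bigl\{\bar c_2(z): z\in\mathcal Z,\ z\text{ satisfies the long-term constraints}\bigr\}=\inf_{\pi,\theta,\rho\ge0}\ \sup_{z\in\mathcal Z}\mathcal L(z;\pi,\theta,\rho),$$ as an equality in $[-\infty,\infty]$ (both sides are $-\infty$ if the primal problem is infeasible). -/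

import Mathlib

open MeasureTheory
open scoped NNReal

namespace CognitiveRadio

/-- A realization `h` of the channel state information with `M` secondary users (SUs) and `K` bands:
the activity flags `a_k` of the primary users (PUs), the SU-to-PU power gains `h_{k,1}^m` and the
SU-to-access-point power gains `h_{k,2}^m`. -/
abbrev CSI (M K : ℕ) : Type :=
  (Fin K → Bool) × (Fin M → Fin K → ℝ≥0) × (Fin M → Fin K → ℝ≥0)

/-- The indicator `a_k ∈ {0, 1}` that the PU of band `k` is active. -/
def CSI.activity {M K : ℕ} (h : CSI M K) (k : Fin K) : ℝ := if h.1 k = true then 1 else 0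

/-- The power gain `h_{k,1}^m` from the SU `m` to the PU receiver of band `k`. -/
def CSI.gainPU {M K : ℕ} (h : CSI M K) (m : Fin M) (k : Fin K) : ℝ := (h.2.1 m k : ℝ)

/-- The power gain `h_{k,2}^m` from the SU `m` to the access point in band `k`. -/
def CSI.gainSU {M K : ℕ} (h : CSI M K) (m : Fin M) (k : Fin K) : ℝ := (h.2.2 m k : ℝ)

/-- The event that the PU of band `k` is active. -/
def activeEvent (M : ℕ) {K : ℕ} (k : Fin K) : Set (CSI M K) := {h | h.1 k = true}

/-- Instantaneous SU rate `r_{k,2}^m (x) = log₂ (1 + x)` at received signal-to-noise ratio `x`. -/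
noncomputable def suRate (x : ℝ) : ℝ := Real.logb 2 (1 + x)

/-- Instantaneous PU rate `r_{k,1} (x) = log₂ (1 + γ / (1 + x))` under interference power `x`. -/
noncomputable def puRate (γ x : ℝ) : ℝ := Real.logb 2 (1 + γ / (1 + x))

/-- The parameters of the resource allocation problem. -/
structure Params (M K : ℕ) where
  /-- priority weights `β^m` -/
  weight : Fin M → ℝ
  /-- interference-free signal-to-noise ratios `γ_k` of the PUs -/
  snr : Fin K → ℝ
  /-- long-term transmit power limits of the SUs -/
  powerLimit : Fin M → ℝ
  /-- long-term interference power limits at the PUs -/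
  interfLimit : Fin K → ℝ
  /-- minimum long-term rates of the PUs -/
  rateMin : Fin K → ℝ
  /-- instantaneous peak power limits, which may depend on the channel realization -/
  peak : Fin M → Fin K → CSI M K → ℝ

/-- The optimization variables. The user `none` is the virtual user: it has zero power and zero rate,
and it is scheduled in a band exactly when no actual SU is. -/
structure Policy (M K : ℕ) where
  /-- scheduling variables `w_{k,2}^m (h)` -/
  sched : Option (Fin M) → Fin K → CSI M K → ℝ
  /-- power variables `p_{k,2}^m (h)` of the actual SUs -/
  power : Fin M → Fin K → CSI M K → ℝ

/-- Lagrange multipliers of the three families of long-term constraints. -/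
structure Multipliers (M K : ℕ) where
  /-- `π^m`, for the SU power constraints -/
  powerMul : Fin M → ℝ
  /-- `θ_k`, for the PU interference power constraints -/
  interfMul : Fin K → ℝ
  /-- `ρ_k`, for the PU capacity constraints -/
  rateMul : Fin K → ℝ

/-- All multipliers are nonnegative. -/
def Multipliers.Nonneg {M K : ℕ} (l : Multipliers M K) : Prop :=
  (∀ m, 0 ≤ l.powerMul m) ∧ (∀ k, 0 ≤ l.interfMul k) ∧ (∀ k, 0 ≤ l.rateMul k)

namespace Policy

variable {M K : ℕ}

/-- Total instantaneous power `∑_k w_{k,2}^m p_{k,2}^m` transmitted by the SU `m`. -/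
noncomputable def txPower (z : Policy M K) (m : Fin M) (h : CSI M K) : ℝ :=
  ∑ k : Fin K, z.sched (some m) k h * z.power m k h

/-- Instantaneous interference power `∑_m w_{k,2}^m h_{k,1}^m p_{k,2}^m` at the PU of band `k`
(the virtual user contributes nothing). -/
noncomputable def interference (z : Policy M K) (k : Fin K) (h : CSI M K) : ℝ :=
  ∑ m : Fin M, z.sched (some m) k h * (h.gainPU m k * z.power m k h)

/-- Instantaneous rate `∑_m w_{k,2}^m r_{k,1} (h_{k,1}^m p_{k,2}^m)` of the PU of band `k`, with the
term of the virtual user, whose power is zero, written first. -/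
noncomputable def primaryRate (P : Params M K) (z : Policy M K) (k : Fin K) (h : CSI M K) : ℝ :=
  z.sched none k h * puRate (P.snr k) 0 +
    ∑ m : Fin M, z.sched (some m) k h * puRate (P.snr k) (h.gainPU m k * z.power m k h)

/-- The short-term constraints, for every channel realization: binary scheduling, exactly one user
(possibly the virtual one) per band, and peak power limits. Policies are measurable functions of the
channel state. -/
structure ShortTerm (P : Params M K) (z : Policy M K) : Prop where
  measurable_sched : ∀ m k, Measurable (z.sched m k)
  measurable_power : ∀ m k, Measurable (z.power m k)
  binary : ∀ m k h, z.sched m k h = 0 ∨ z.sched m k h = 1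
  orthogonal : ∀ k h, ∑ m : Option (Fin M), z.sched m k h = 1
  power_nonneg : ∀ m k h, 0 ≤ z.power m k h
  power_le_peak : ∀ m k h, z.power m k h ≤ P.peak m k h

/-- The long-term constraints. Those on the PU of band `k` are expectations conditioned on that PU
being active; they are void if it is almost surely inactive. -/
structure LongTerm (P : Params M K) (μ : Measure (CSI M K)) (z : Policy M K) : Prop where
  power : ∀ m, ∫ h, z.txPower m h ∂μ ≤ P.powerLimit m
  interference : ∀ k, μ (activeEvent M k) ≠ 0 →
    ∫ h, z.interference k h ∂(ProbabilityTheory.cond μ (activeEvent M k)) ≤ P.interfLimit k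
  rate : ∀ k, μ (activeEvent M k) ≠ 0 →
    P.rateMin k ≤ ∫ h, z.primaryRate P k h ∂(ProbabilityTheory.cond μ (activeEvent M k))

/-- The weighted ergodic sum-capacity of the SUs. -/
noncomputable def objective (P : Params M K) (μ : Measure (CSI M K)) (z : Policy M K) : ℝ :=
  ∑ k : Fin K, ∑ m : Fin M,
    ∫ h, P.weight m * z.sched (some m) k h * suRate (h.gainSU m k * z.power m k h) ∂μ

/-- The Lagrangian in which only the long-term constraints are dualized. -/
noncomputable def lagrangian (P : Params M K) (μ : Measure (CSI M K)) (z : Policy M K)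
    (l : Multipliers M K) : ℝ :=
  ∫ h, ((∑ k : Fin K, ∑ m : Fin M,
        P.weight m * z.sched (some m) k h * suRate (h.gainSU m k * z.power m k h))
      - (∑ m : Fin M, l.powerMul m * (z.txPower m h - P.powerLimit m))
      - (∑ k : Fin K, l.interfMul k * (h.activity k * (z.interference k h - P.interfLimit k)))
      + ∑ k : Fin K, l.rateMul k * (h.activity k * (z.primaryRate P k h - P.rateMin k))) ∂μ

end Policy

/-- The optimal value of the primal problem (`⊥` if it is infeasible). -/
noncomputable def primalValue {M K : ℕ} (P : Params M K) (μ : Measure (CSI M K)) : EReal :=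
  ⨆ (z : Policy M K) (_ : z.ShortTerm P ∧ z.LongTerm P μ), ((z.objective P μ : ℝ) : EReal)

/-- The dual function: the Lagrangian maximized under the short-term constraints alone. -/
noncomputable def dualFunction {M K : ℕ} (P : Params M K) (μ : Measure (CSI M K))
    (l : Multipliers M K) : EReal :=
  ⨆ (z : Policy M K) (_ : z.ShortTerm P), ((z.lagrangian P μ l : ℝ) : EReal)

/-- The optimal value of the dual problem. -/
noncomputable def dualValue {M K : ℕ} (P : Params M K) (μ : Measure (CSI M K)) : EReal :=
  ⨅ (l : Multipliers M K) (_ : l.Nonneg), dualFunction P μ l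

end CognitiveRadio

/-! Send each admissible policy to the vector whose entries are its objective and the expected
slacks of its long-term constraints, and let `A` be the set of these vectors. The Lagrangian is the
`none` entry plus a nonnegative combination of the others, so the claim concerns the
finite-dimensional set `A` alone. Binary scheduling makes the problem nonconvex pointwise; averaging
over a non-atomic channel makes `A` convex and compact, and then separation gives duality without a
Slater condition.

Convexity is Lyapunov's theorem (`exists_setIntegral_eq_mul`): some event carries the fraction `t`
of the integrals of finitely many functions at once, and two policies may be glued along it because
the short-term constraints act state by state.

Compactness (`Decomposable.isCompact_integrals`) reduces to extreme points of the closure of `A`,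
since by Minkowski's theorem they span it. Suppose policies have vectors tending to an extreme
point. Exchanging two late policies where one slack integrand exceeds the other yields two points of
`A` with midpoint near the extreme point; extremality forces these points together, which says that
the integrands are Cauchy in L¹. Along an almost surely convergent subsequence, a measurable
pointwise cluster policy (`exists_cluster_policy`) attains the limit.

Finally, for real `r` above the primal value, `A` misses the closed convex set of vectors with
objective at least `r` and nonnegative slacks. The separating functional supplies multipliers
(`exists_multiplier`), including when the primal is infeasible. -/

namespace CognitiveRadio

open Set Filter Topology

/-! ### Lyapunov's convexity theorem by repeated halving -/

section Lyapunov

variable {H : Type*} [MeasurableSpace H] {μ : Measure H}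

/-- Every measurable set has a measurable subset on which all functions of `F` have half of their
integral. -/
def Halves (μ : Measure H) (F : Set (H → ℝ)) : Prop :=
  ∀ A, MeasurableSet A → ∃ B ⊆ A, MeasurableSet B ∧
    ∀ f ∈ F, ∫ x in B, f x ∂μ = 1 / 2 * ∫ x in A, f x ∂μ

/-- `u` slices the set `A` proportionally for all functions of `F`. -/
structure Slices (μ : Measure H) (F : Set (H → ℝ)) (A : Set H) (u : H → ℝ) : Prop where
  measurable : Measurable u
  nonneg : ∀ x, 0 ≤ u x
  le_one : ∀ x, u x ≤ 1
  setIntegral : ∀ f ∈ F, ∀ t ∈ Icc (0 : ℝ) 1,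
    ∫ x in A ∩ {x | u x ≤ t}, f x ∂μ = t * ∫ x in A, f x ∂μ

/-- Dominated convergence: at `t` the indicator of the sublevel set is locally constant in the
level, except at points with `u x = t`, which are null in `A`. -/
theorem continuous_setIntegral_sublevel {A : Set H} (hA : MeasurableSet A) {u f : H → ℝ}
    (hu : Measurable u) (hf : Integrable f μ) (h0 : ∀ t, μ (A ∩ {x | u x = t}) = 0) :
    Continuous fun t : ℝ => ∫ x in A ∩ {x | u x ≤ t}, f x ∂μ := by
  have hm : ∀ t : ℝ, MeasurableSet {x | u x ≤ t} := fun t => measurableSet_le hu measurable_const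
  have heq : ∀ t : ℝ, ∫ x in A ∩ {x | u x ≤ t}, f x ∂μ
      = ∫ x in A, {x | u x ≤ t}.indicator f x ∂μ := by
    intro t
    rw [setIntegral_indicator (hm t)]
  simp_rw [heq]
  refine continuous_iff_continuousAt.2 fun t => ?_
  refine continuousAt_of_dominated (bound := fun x => ‖f x‖) ?_ ?_ hf.norm.integrableOn ?_
  · exact Eventually.of_forall fun s => (hf.indicator (hm s)).aestronglyMeasurable.restrict
  · exact Eventually.of_forall fun s => Eventually.of_forall fun x => norm_indicator_le_norm_self _ _
  · have : ∀ᵐ x ∂(μ.restrict A), u x ≠ t := by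
      rw [ae_restrict_iff' hA]
      rw [ae_iff]
      convert h0 t using 2
      ext x
      simp
    filter_upwards [this] with x hx
    rcases lt_or_gt_of_ne hx with h | h
    · refine (continuousAt_const (y := f x)).congr ?_
      filter_upwards [lt_mem_nhds h] with s hs
      simp [indicator, hs.le]
    · refine (continuousAt_const (y := (0 : ℝ))).congr ?_
      filter_upwards [gt_mem_nhds h] with s hs
      simp [indicator, not_le.2 hs]

/-- A standard Borel space embeds measurably in `ℝ`. Injectivity makes every level set at most a
single point, hence null, so the mass below a level is continuous and takes the value one half by
the intermediate value theorem. -/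
theorem halves_one [StandardBorelSpace H] [IsFiniteMeasure μ] [NullSingletonClass μ] :
    Halves μ {fun _ => (1 : ℝ)} := by
  intro A hA
  obtain ⟨e, he⟩ := exists_measurableEmbedding_real H
  set u : H → ℝ := fun x => Real.arctan (e x) with hu_def
  have hu : Measurable u := Real.measurable_arctan.comp he.measurable
  have hinj : Function.Injective u := Real.arctan_injective.comp he.injective
  have hnull : ∀ t, μ (A ∩ {x | u x = t}) = 0 := by
    intro t
    refine measure_mono_null inter_subset_right (Set.Subsingleton.measure_zero ?_ μ)
    intro x hx y hy
    exact hinj (Eq.trans hx (Eq.symm hy))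
  have hc := continuous_setIntegral_sublevel (μ := μ) hA hu (integrable_const (1 : ℝ)) hnull
  -- Composing with `arctan` keeps the embedding strictly between -2 and 2, so these two levels give
  -- the empty set and all of `A`.
  have hpi := Real.pi_le_four
  have h0 : ∫ x in A ∩ {x | u x ≤ -2}, (1 : ℝ) ∂μ = 0 := by
    have : A ∩ {x | u x ≤ -2} = ∅ := by
      ext x
      have := Real.neg_pi_div_two_lt_arctan (e x)
      simp only [mem_inter_iff, mem_ofPred_eq, mem_empty_iff_false, iff_false, not_and, not_le,
        hu_def]
      intro _
      linarith
    rw [this]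
    simp
  have h1 : A ∩ {x | u x ≤ 2} = A := by
    refine inter_eq_left.2 fun x _ => ?_
    have := Real.arctan_lt_pi_div_two (e x)
    simp only [mem_ofPred_eq, hu_def]
    linarith
  have hpos : 0 ≤ ∫ x in A, (1 : ℝ) ∂μ := integral_nonneg fun _ => zero_le_one
  obtain ⟨t, ht⟩ := mem_range_of_exists_le_of_exists_ge hc
    (c := 1 / 2 * ∫ x in A, (1 : ℝ) ∂μ) ⟨-2, by rw [h0]; positivity⟩
    ⟨2, by rw [h1]; linarith⟩
  refine ⟨A ∩ {x | u x ≤ t}, inter_subset_left,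
    hA.inter (measurableSet_le hu measurable_const), ?_⟩
  rintro f rfl
  exact ht

/-- The first `n` binary digits of a slicing function, as an integer. -/
noncomputable def digits (half : Set H → Set H) (A : Set H) : ℕ → H → ℕ
  | 0, _ => 0
  | n + 1, x =>
    open Classical in
    2 * digits half A n x +
      if x ∈ half (A ∩ {y | digits half A n y = digits half A n x}) then 0 else 1

/-- Halving `A`, then both pieces, and so on gives `2 ^ n` cells with equal integrals at stage `n`.
Reading a point's successive choices as binary digits defines `u`; dyadic levels are unions of
cells, and other levels follow by approximation. -/
theorem Halves.exists_slices [IsFiniteMeasure μ] {F : Set (H → ℝ)} (hF : Halves μ F)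
    (hint : ∀ f ∈ F, Integrable f μ) (hone : (fun _ => (1 : ℝ)) ∈ F) {A : Set H}
    (hA : MeasurableSet A) : ∃ u, Slices μ F A u := by
  choose! half hsub hmeas hhalf using hF
  set N := digits half A with hN
  have hsucc : ∀ n x, (x ∈ half (A ∩ {y | N n y = N n x}) ∧ N (n + 1) x = 2 * N n x) ∨
      (x ∉ half (A ∩ {y | N n y = N n x}) ∧ N (n + 1) x = 2 * N n x + 1) := by
    intro n x
    by_cases h : x ∈ half (A ∩ {y | N n y = N n x})
    · left
      refine ⟨h, ?_⟩
      rw [hN, digits, if_pos h]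
      rfl
    · right
      refine ⟨h, ?_⟩
      rw [hN, digits, if_neg h]
  have hpre_even : ∀ n j, {x | N (n + 1) x = 2 * j} =
      {x | N n x = j} ∩ half (A ∩ {y | N n y = j}) := by
    intro n j
    ext x
    simp only [mem_ofPred_eq, mem_inter_iff]
    constructor
    · intro h
      rcases hsucc n x with ⟨h1, h2⟩ | ⟨h1, h2⟩
      · have : N n x = j := by omega
        rw [this] at h1
        exact ⟨this, h1⟩
      · omega
    · rintro ⟨rfl, h⟩
      rcases hsucc n x with ⟨h1, h2⟩ | ⟨h1, h2⟩
      · exact h2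
      · exact absurd h h1
  have hpre_odd : ∀ n j, {x | N (n + 1) x = 2 * j + 1} =
      {x | N n x = j} \ half (A ∩ {y | N n y = j}) := by
    intro n j
    ext x
    simp only [mem_ofPred_eq, Set.mem_sdiff]
    constructor
    · intro h
      rcases hsucc n x with ⟨h1, h2⟩ | ⟨h1, h2⟩
      · omega
      · have : N n x = j := by omega
        rw [this] at h1
        exact ⟨this, h1⟩
    · rintro ⟨rfl, h⟩
      rcases hsucc n x with ⟨h1, h2⟩ | ⟨h1, h2⟩
      · exact absurd h1 h
      · exact h2
  have hNm : ∀ n, ∀ j, MeasurableSet {x | N n x = j} := by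
    intro n
    induction n with
    | zero => intro j; simp [hN, digits]
    | succ n ih =>
      intro j
      rcases Nat.even_or_odd' j with ⟨i, rfl | rfl⟩
      · rw [hpre_even]
        exact (ih i).inter (hmeas _ (hA.inter (ih i)))
      · rw [hpre_odd]
        exact (ih i).diff (hmeas _ (hA.inter (ih i)))
  have hlt : ∀ n x, N n x < 2 ^ n := by
    intro n x
    induction n with
    | zero => simp [hN, digits]
    | succ n ih =>
      rw [pow_succ]
      rcases hsucc n x with ⟨-, h2⟩ | ⟨-, h2⟩ <;> omega
  have hcell : ∀ f ∈ F, ∀ n j, j < 2 ^ n →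
      ∫ x in A ∩ {x | N n x = j}, f x ∂μ = (∫ x in A, f x ∂μ) / 2 ^ n := by
    intro f hf n
    induction n with
    | zero => intro j hj; simp [hN, digits, show j = 0 by simpa using hj]
    | succ n ih =>
      intro j hj
      rw [pow_succ] at hj
      have hS : ∀ i, MeasurableSet (A ∩ {x | N n x = i}) := fun i => hA.inter (hNm n i)
      rcases Nat.even_or_odd' j with ⟨i, rfl | rfl⟩
      · have : A ∩ {x | N (n + 1) x = 2 * i} = half (A ∩ {y | N n y = i}) := by
          rw [hpre_even, ← inter_assoc]
          exact inter_eq_right.2 (hsub _ (hS i))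
        rw [this, hhalf _ (hS i) f hf, ih i (by omega), pow_succ]
        ring
      · have : A ∩ {x | N (n + 1) x = 2 * i + 1} =
            (A ∩ {y | N n y = i}) \ half (A ∩ {y | N n y = i}) := by
          rw [hpre_odd, inter_sdiff_assoc]
        rw [this, setIntegral_sdiff (hmeas _ (hS i)) (hint f hf).integrableOn (hsub _ (hS i)),
          hhalf _ (hS i) f hf, ih i (by omega), pow_succ]
        ring
  have hNmeas : ∀ n, Measurable (N n) := fun n => measurable_to_countable' fun j => hNm n j
  have hbelow : ∀ f ∈ F, ∀ n j, j ≤ 2 ^ n →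
      ∫ x in A ∩ {x | N n x < j}, f x ∂μ = j * ((∫ x in A, f x ∂μ) / 2 ^ n) := by
    intro f hf n j
    induction j with
    | zero => intro _; simp
    | succ j ih =>
      intro hj
      have : A ∩ {x | N n x < j + 1} = (A ∩ {x | N n x < j}) ∪ (A ∩ {x | N n x = j}) := by
        rw [← inter_union_distrib_left]
        congr 1
        ext x
        simp only [mem_ofPred_eq, mem_union]
        omega
      rw [this, setIntegral_union _ (hA.inter (hNm n j)) (hint f hf).integrableOn
        (hint f hf).integrableOn, ih (by omega), hcell f hf n j (by omega)]
      · push_cast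
        ring
      · refine disjoint_left.2 ?_
        rintro x ⟨-, h1⟩ ⟨-, h2⟩
        simp only [mem_ofPred_eq] at h1 h2
        omega
  set a : ℕ → H → ℝ := fun n x => N n x / 2 ^ n with ha
  have hmono : ∀ x, Monotone fun n => a n x := by
    intro x
    refine monotone_nat_of_le_succ fun n => ?_
    simp only [ha, pow_succ]
    rw [div_le_div_iff₀ (by positivity) (by positivity)]
    have : 2 * (N n x : ℝ) ≤ N (n + 1) x := by
      rcases hsucc n x with ⟨-, h2⟩ | ⟨-, h2⟩ <;> rw [h2] <;> push_cast <;> linarith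
    nlinarith [show (0 : ℝ) < 2 ^ n by positivity]
  -- Together with `hmono` this traps `u x` between `N n x / 2 ^ n` and `(N n x + 1) / 2 ^ n`.
  have hanti : ∀ x, Antitone fun n => ((N n x : ℝ) + 1) / 2 ^ n := by
    intro x
    refine antitone_nat_of_succ_le fun n => ?_
    simp only [pow_succ]
    rw [div_le_div_iff₀ (by positivity) (by positivity)]
    have : (N (n + 1) x : ℝ) ≤ 2 * N n x + 1 := by
      rcases hsucc n x with ⟨-, h2⟩ | ⟨-, h2⟩ <;> rw [h2] <;> push_cast <;> linarith
    nlinarith [show (0 : ℝ) < 2 ^ n by positivity]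
  have hle : ∀ x m n, a m x ≤ ((N n x : ℝ) + 1) / 2 ^ n := by
    intro x m n
    have h1 := hmono x (le_max_left m n)
    have h2 := hanti x (le_max_right m n)
    refine h1.trans (le_trans ?_ h2)
    simp only [ha]
    gcongr
    linarith
  have hbdd : ∀ x, BddAbove (range fun n => a n x) := fun x =>
    ⟨_, by rintro _ ⟨m, rfl⟩; exact hle x m 0⟩
  set u : H → ℝ := fun x => ⨆ n, a n x with hu
  have hu_ge : ∀ n x, a n x ≤ u x := fun n x => le_ciSup (hbdd x) n
  have hu_le : ∀ n x, u x ≤ ((N n x : ℝ) + 1) / 2 ^ n := fun n x => ciSup_le fun m => hle x m n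
  have hum : Measurable u := Measurable.iSup fun n =>
    ((measurable_from_nat (f := fun k : ℕ => (k : ℝ))).comp (hNmeas n)).div_const _
  have hu0 : ∀ x, 0 ≤ u x := fun x => le_trans (by simp [ha]) (hu_ge 0 x)
  have hu1 : ∀ x, u x ≤ 1 := fun x => by
    have := hu_le 0 x
    simpa [hN, digits] using this
  refine ⟨u, hum, hu0, hu1, ?_⟩
  intro f hf t ht
  -- At `t = 1` the index `j n` below would be `2 ^ n`, which labels no cell.
  rcases eq_or_lt_of_le ht.2 with rfl | ht1
  · have : {x | u x ≤ 1} = univ := eq_univ_of_forall hu1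
    rw [this, inter_univ, one_mul]
  set j : ℕ → ℕ := fun n => ⌊t * 2 ^ n⌋₊ with hj
  have hj1 : ∀ n, (j n : ℝ) ≤ t * 2 ^ n := fun n => Nat.floor_le (by have := ht.1; positivity)
  have hj2 : ∀ n, t * 2 ^ n < j n + 1 := fun n => Nat.lt_floor_add_one _
  have hjlt : ∀ n, j n < 2 ^ n := by
    intro n
    have h1 := hj1 n
    have h2 : t * 2 ^ n < 2 ^ n := by
      have : (0 : ℝ) < 2 ^ n := by positivity
      nlinarith
    exact_mod_cast h1.trans_lt h2
  have hsub1 : ∀ n, A ∩ {x | N n x < j n} ⊆ A ∩ {x | u x ≤ t} := by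
    rintro n x ⟨hxA, hx⟩
    refine ⟨hxA, (hu_le n x).trans ?_⟩
    rw [div_le_iff₀ (by positivity)]
    refine le_trans ?_ (hj1 n)
    exact_mod_cast hx
  -- The sublevel set and its dyadic inner approximation differ inside the single cell `j n`.
  set D : ℕ → Set H := fun n => (A ∩ {x | u x ≤ t}) \ (A ∩ {x | N n x < j n}) with hD
  have hDsub : ∀ n, D n ⊆ A ∩ {x | N n x = j n} := by
    rintro n x ⟨⟨hxA, hx⟩, hx2⟩
    refine ⟨hxA, ?_⟩
    have h1 : ¬ N n x < j n := fun h => hx2 ⟨hxA, h⟩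
    have h2 : (N n x : ℝ) ≤ t * 2 ^ n := by
      have := (hu_ge n x).trans hx
      rwa [ha, div_le_iff₀ (by positivity)] at this
    have h3 : (N n x : ℝ) < j n + 1 := h2.trans_lt (hj2 n)
    have h4 : N n x < j n + 1 := by exact_mod_cast h3
    simp only [mem_ofPred_eq]
    omega
  have htwo : Tendsto (fun n : ℕ => (1 / 2 : ℝ) ^ n) atTop (𝓝 0) :=
    tendsto_pow_atTop_nhds_zero_of_lt_one (by norm_num) (by norm_num)
  -- Membership of the constant 1 in `F` is what makes the cells small in measure.
  have hDmeas : Tendsto (fun n => μ (D n)) atTop (𝓝 0) := by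
    have h1 : ∀ n, μ.real (A ∩ {x | N n x = j n}) = μ.real A * (1 / 2) ^ n := by
      intro n
      have := hcell _ hone n (j n) (hjlt n)
      simp only [setIntegral_const, smul_eq_mul, mul_one] at this
      rw [this, div_eq_mul_inv]
      simp
    have h2 : Tendsto (fun n => ENNReal.ofReal (μ.real A * (1 / 2) ^ n)) atTop (𝓝 0) := by
      rw [← ENNReal.ofReal_zero]
      refine ENNReal.tendsto_ofReal ?_
      simpa using htwo.const_mul (μ.real A)
    refine tendsto_of_tendsto_of_tendsto_of_le_of_le tendsto_const_nhds h2 (fun _ => zero_le)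
      fun n => ?_
    refine (measure_mono (hDsub n)).trans ?_
    rw [← h1, ofReal_measureReal]
  have hDint := (hint f hf).tendsto_setIntegral_nhds_zero hDmeas
  have hdiff : ∀ n, ∫ x in D n, f x ∂μ = ∫ x in A ∩ {x | u x ≤ t}, f x ∂μ -
      j n * ((∫ x in A, f x ∂μ) / 2 ^ n) := by
    intro n
    rw [hD, setIntegral_sdiff (hA.inter (measurableSet_lt (hNmeas n) measurable_const))
      (hint f hf).integrableOn (hsub1 n), hbelow f hf n (j n) (hjlt n).le]
  have hjt : Tendsto (fun n => (j n : ℝ) / 2 ^ n) atTop (𝓝 t) := by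
    have h1 : Tendsto (fun n : ℕ => t - (1 / 2 : ℝ) ^ n) atTop (𝓝 t) := by
      simpa using htwo.const_sub t
    refine tendsto_of_tendsto_of_tendsto_of_le_of_le h1 tendsto_const_nhds ?_ ?_
    · intro n
      have h2 : (0 : ℝ) < 2 ^ n := by positivity
      simp only
      rw [le_div_iff₀ h2, sub_mul, one_div, inv_pow, inv_mul_cancel₀ h2.ne']
      linarith [hj2 n]
    · intro n
      simp only
      rw [div_le_iff₀ (by positivity)]
      exact hj1 n
  have hlim : Tendsto (fun n => ∫ x in D n, f x ∂μ) atTop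
      (𝓝 (∫ x in A ∩ {x | u x ≤ t}, f x ∂μ - t * ∫ x in A, f x ∂μ)) := by
    refine ((hjt.mul_const (∫ x in A, f x ∂μ)).const_sub _).congr fun n => ?_
    rw [hdiff]
    ring
  exact sub_eq_zero.1 (tendsto_nhds_unique hlim hDint)

/-- Applied to the constant 1, slicing gives mass `t * μ.real A` below level `t`; this is continuous
in `t`, so no level carries mass. -/
theorem Slices.null_level [IsFiniteMeasure μ] {F : Set (H → ℝ)} {A : Set H} {u : H → ℝ}
    (hA : MeasurableSet A) (hu : Slices μ F A u) (hone : (fun _ => (1 : ℝ)) ∈ F) (t : ℝ) :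
    μ (A ∩ {x | u x = t}) = 0 := by
  have hval : ∀ t ∈ Icc (0 : ℝ) 1, μ.real (A ∩ {x | u x ≤ t}) = t * μ.real A := by
    intro t ht
    simpa using hu.setIntegral _ hone t ht
  have hm : ∀ t : ℝ, MeasurableSet {x | u x ≤ t} := fun t =>
    measurableSet_le hu.measurable measurable_const
  rcases lt_trichotomy t 0 with h | rfl | h
  · convert measure_empty (μ := μ)
    ext x
    simp only [mem_inter_iff, mem_ofPred_eq, mem_empty_iff_false, iff_false, not_and]
    rintro _ rfl
    exact absurd (hu.nonneg x) (not_le.2 h)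
  · have h0 := hval 0 (by simp)
    rw [zero_mul, measureReal_eq_zero_iff] at h0
    exact measure_mono_null (inter_subset_inter_right _ fun x hx => le_of_eq hx) h0
  · by_cases h1 : t ≤ 1
    · rw [← measureReal_eq_zero_iff]
      refine le_antisymm (le_of_forall_pos_le_add fun ε hε => ?_) measureReal_nonneg
      set δ := min t (ε / (μ.real A + 1)) with hδ
      have hpos : 0 ≤ μ.real A := measureReal_nonneg
      have hδ0 : 0 < δ := lt_min h (by positivity)
      have hδt : δ ≤ t := min_le_left _ _
      have hδε : δ * μ.real A ≤ ε := by
        have h2 : δ ≤ ε / (μ.real A + 1) := min_le_right _ _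
        rw [le_div_iff₀ (by positivity)] at h2
        nlinarith
      have hsub : A ∩ {x | u x ≤ t - δ} ⊆ A ∩ {x | u x ≤ t} :=
        inter_subset_inter_right _ fun x (hx : u x ≤ t - δ) => show u x ≤ t by linarith
      have h3 : μ.real (A ∩ {x | u x = t}) ≤
          μ.real ((A ∩ {x | u x ≤ t}) \ (A ∩ {x | u x ≤ t - δ})) := by
        refine measureReal_mono ?_
        rintro x ⟨hxA, hx⟩
        simp only [mem_ofPred_eq] at hx
        refine ⟨⟨hxA, hx.le⟩, fun h' => ?_⟩
        have := h'.2
        simp only [mem_ofPred_eq] at this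
        linarith
      rw [measureReal_sdiff hsub (hA.inter (hm _)), hval t ⟨h.le, h1⟩,
        hval (t - δ) ⟨by linarith, by linarith⟩] at h3
      linarith
    · convert measure_empty (μ := μ)
      ext x
      simp only [mem_inter_iff, mem_ofPred_eq, mem_empty_iff_false, iff_false, not_and]
      rintro _ rfl
      exact h1 (hu.le_one x)

/-- Slide a window `t < u ≤ t + 1/2`. Every position halves the functions already in `F`, which
leaves one free parameter to halve `f` by continuity. -/
theorem Halves.insert [IsFiniteMeasure μ] {F : Set (H → ℝ)} (hF : Halves μ F)
    (hint : ∀ f ∈ F, Integrable f μ) (hone : (fun _ => (1 : ℝ)) ∈ F) {f : H → ℝ}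
    (hf : Integrable f μ) : Halves μ (insert f F) := by
  intro A hA
  obtain ⟨u, hu⟩ := hF.exists_slices hint hone hA
  have hm : ∀ t : ℝ, MeasurableSet (A ∩ {x | u x ≤ t}) := fun t =>
    hA.inter (measurableSet_le hu.measurable measurable_const)
  have hnull := hu.null_level hA hone
  have hc := continuous_setIntegral_sublevel hA hu.measurable hf hnull
  set Φ : ℝ → ℝ := fun t => ∫ x in A ∩ {x | u x ≤ t}, f x ∂μ with hΦ
  have h0 : Φ 0 = 0 := by
    refine setIntegral_measure_zero _ (measure_mono_null ?_ (hnull 0))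
    exact inter_subset_inter_right _ fun x hx => le_antisymm hx (hu.nonneg x)
  have h1 : Φ 1 = ∫ x in A, f x ∂μ := by
    have : {x | u x ≤ 1} = univ := eq_univ_of_forall hu.le_one
    simp only [hΦ, this, inter_univ]
  have hφ : Continuous fun t => Φ (t + 1 / 2) - Φ t :=
    (hc.comp (continuous_id.add continuous_const)).sub hc
  -- The windows at `0` and `1/2` split `A` up to a null set, so their `f`-integrals add up to the
  -- total and one half of it lies between them.
  have hmem : 1 / 2 * ∫ x in A, f x ∂μ ∈
      uIcc ((fun t => Φ (t + 1 / 2) - Φ t) 0) ((fun t => Φ (t + 1 / 2) - Φ t) (1 / 2)) := by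
    simp only [zero_add]
    rw [show (1 / 2 + 1 / 2 : ℝ) = 1 by norm_num, h0, h1, mem_uIcc]
    rcases le_total (Φ (1 / 2)) (1 / 2 * ∫ x in A, f x ∂μ) with h | h
    · left; constructor <;> linarith
    · right; constructor <;> linarith
  obtain ⟨t, ht, hteq⟩ := intermediate_value_uIcc hφ.continuousOn hmem
  rw [uIcc_of_le (by norm_num)] at ht
  have hsub : A ∩ {x | u x ≤ t} ⊆ A ∩ {x | u x ≤ t + 1 / 2} :=
    inter_subset_inter_right _ fun x (hx : u x ≤ t) => show u x ≤ t + 1 / 2 by linarith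
  refine ⟨(A ∩ {x | u x ≤ t + 1 / 2}) \ (A ∩ {x | u x ≤ t}),
    sdiff_subset.trans inter_subset_left, (hm _).diff (hm _), ?_⟩
  rintro g (rfl | hg)
  · rw [setIntegral_sdiff (hm _) hf.integrableOn hsub]
    exact hteq
  · rw [setIntegral_sdiff (hm _) (hint g hg).integrableOn hsub,
      hu.setIntegral g hg _ ⟨by linarith [ht.1], by linarith [ht.2]⟩,
      hu.setIntegral g hg _ ⟨ht.1, by linarith [ht.2]⟩]
    ring

/-- **Lyapunov's convexity theorem** in the form used below. -/
theorem exists_setIntegral_eq_mul [StandardBorelSpace H] [IsFiniteMeasure μ]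
    [NullSingletonClass μ] {ι : Type*} [Finite ι] {f : ι → H → ℝ} (hf : ∀ i, Integrable (f i) μ)
    {t : ℝ} (ht : t ∈ Icc (0 : ℝ) 1) :
    ∃ E, MeasurableSet E ∧ ∀ i, ∫ x in E, f i x ∂μ = t * ∫ x, f i x ∂μ := by
  -- The constant 1 is carried through the induction, since `Halves.insert` needs it.
  have key : ∀ F : Set (H → ℝ), F.Finite → (∀ g ∈ F, Integrable g μ) →
      Halves μ (F ∪ {fun _ => (1 : ℝ)}) := by
    intro F hF
    induction F, hF using Set.Finite.induction_on with
    | empty => intro _; simpa using halves_one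
    | @insert g F _ _ ih =>
      intro hint
      rw [insert_union]
      refine (ih fun g hg => hint g (mem_insert_of_mem _ hg)).insert ?_ (by simp)
        (hint g (mem_insert _ _))
      rintro g (hg | rfl)
      · exact hint g (mem_insert_of_mem _ hg)
      · exact integrable_const _
  have hh := key (range f) (finite_range f) (by rintro _ ⟨i, rfl⟩; exact hf i)
  obtain ⟨u, hu⟩ := hh.exists_slices
    (by rintro g (⟨i, rfl⟩ | rfl); exacts [hf i, integrable_const _]) (by simp) MeasurableSet.univ
  refine ⟨{x | u x ≤ t}, measurableSet_le hu.measurable measurable_const, fun i => ?_⟩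
  simpa using hu.setIntegral (f i) (Or.inl ⟨i, rfl⟩) t ht

end Lyapunov

/-! ### Extreme points of compact convex sets -/

section Minkowski

variable {E : Type*} [NormedAddCommGroup E] [NormedSpace ℝ E]

/-- The directions in which a convex set `C` extends on both sides of `x`. -/
def faceDirections {C : Set E} (hC : Convex ℝ C) {x : E} (hx : x ∈ C) : Submodule ℝ E where
  carrier := {d | ∃ ε > 0, ∀ s : ℝ, |s| ≤ ε → x + s • d ∈ C}
  zero_mem' := ⟨1, one_pos, fun s _ => by simpa using hx⟩
  add_mem' := by
    rintro d e ⟨ε, hε, hd⟩ ⟨δ, hδ, he⟩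
    refine ⟨min ε δ / 2, by positivity, fun s hs => ?_⟩
    have h2 : |2 * s| ≤ min ε δ := by rw [abs_mul, abs_two]; linarith
    have := hC (hd (2 * s) (h2.trans (min_le_left _ _))) (he (2 * s) (h2.trans (min_le_right _ _)))
      (a := 1 / 2) (b := 1 / 2) (by norm_num) (by norm_num) (by norm_num)
    convert this using 1
    module
  smul_mem' := by
    rintro c d ⟨ε, hε, hd⟩
    refine ⟨ε / (|c| + 1), by positivity, fun s hs => ?_⟩
    rw [smul_smul]
    refine hd _ ?_
    rw [le_div_iff₀ (by positivity)] at hs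
    rw [abs_mul]
    nlinarith [abs_nonneg s, abs_nonneg c]

/-- If `x` were inside a segment from `z` to `y`, then `y - z` would be a face direction, hence
zero. -/
theorem mem_extremePoints_of_faceDirections_eq_bot {C : Set E} (hC : Convex ℝ C) {x : E}
    (hx : x ∈ C) (h : faceDirections hC hx = ⊥) : x ∈ C.extremePoints ℝ := by
  rw [mem_extremePoints]
  refine ⟨hx, ?_⟩
  rintro y hy z hz ⟨a, b, ha, hb, hab, rfl⟩
  have hd : y - z ∈ faceDirections hC hx := by
    refine ⟨min a b, lt_min ha hb, fun s hs => ?_⟩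
    obtain ⟨h1, h2⟩ := abs_le.1 hs
    have := hC hy hz (a := a + s) (b := b - s) (by linarith [min_le_left a b])
      (by linarith [min_le_right a b]) (by linarith)
    convert this using 1
    module
  rw [h, Submodule.mem_bot, sub_eq_zero] at hd
  subst hd
  rw [← add_smul, hab, one_smul]
  exact ⟨rfl, rfl⟩

/-- A segment around `y`, mixed with the fixed point `w`, becomes a segment around `x` shrunk by the
factor `a`. -/
theorem faceDirections_le {C : Set E} (hC : Convex ℝ C) {x y w : E} (hx : x ∈ C) (hy : y ∈ C)
    (hw : w ∈ C) {a b : ℝ} (ha : 0 < a) (hb : 0 ≤ b) (hab : a + b = 1) (h : x = a • y + b • w) :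
    faceDirections hC hy ≤ faceDirections hC hx := by
  rintro d ⟨ε, hε, hd⟩
  refine ⟨a * ε, by positivity, fun s hs => ?_⟩
  have h1 : |s / a| ≤ ε := by
    rw [abs_div, abs_of_pos ha, div_le_iff₀ ha]
    linarith
  have := hC (hd _ h1) hw ha.le hb hab
  convert this using 1
  rw [h, smul_add, smul_smul, mul_div_cancel₀ _ ha.ne']
  abel

/-- Compactness gives a largest admissible step along `d`; past it the line leaves `C`, so `d` is
lost as a face direction there. -/
theorem exists_exit_point {C : Set E} (hC : Convex ℝ C) (hcomp : IsCompact C) {x d : E}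
    (hx : x ∈ C) (hd : d ∈ faceDirections hC hx) (hd0 : d ≠ 0) :
    ∃ s : ℝ, 0 < s ∧ ∃ hy : x + s • d ∈ C, d ∉ faceDirections hC hy := by
  obtain ⟨ε, hε, hd⟩ := hd
  have hcont : Continuous fun s : ℝ => x + s • d := by fun_prop
  have hS : IsCompact {s : ℝ | x + s • d ∈ C} := by
    refine Metric.isCompact_of_isClosed_isBounded (hcomp.isClosed.preimage hcont) ?_
    obtain ⟨R, hR⟩ := hcomp.isBounded.exists_norm_le
    refine isBounded_iff_forall_norm_le.2 ⟨(R + ‖x‖) / ‖d‖, fun s hs => ?_⟩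
    rw [le_div_iff₀ (norm_pos_iff.2 hd0), ← norm_smul]
    have h1 := hR _ hs
    have h2 := norm_sub_le (x + s • d) x
    rw [add_sub_cancel_left] at h2
    linarith
  have hεS : x + ε • d ∈ C := hd ε (abs_of_pos hε).le
  obtain ⟨s, hs, hmax⟩ := hS.exists_isMaxOn ⟨ε, hεS⟩ continuous_id.continuousOn
  have hεs : ε ≤ s := hmax (show ε ∈ {s : ℝ | x + s • d ∈ C} from hεS)
  refine ⟨s, hε.trans_le hεs, hs, ?_⟩
  rintro ⟨δ, hδ, h⟩
  have h1 := h δ (abs_of_pos hδ).le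
  rw [add_assoc, ← add_smul] at h1
  have : s + δ ≤ s := hmax (show s + δ ∈ {s : ℝ | x + s • d ∈ C} from h1)
  linarith

/-- **Minkowski's theorem**: in finite dimension a compact convex set is the convex hull of its
extreme points. -/
theorem convexHull_extremePoints_eq [FiniteDimensional ℝ E] {C : Set E} (hC : Convex ℝ C)
    (hcomp : IsCompact C) : convexHull ℝ (C.extremePoints ℝ) = C := by
  refine (convexHull_min extremePoints_subset hC).antisymm ?_
  -- Induction on the dimension of the face: `x` lies between two exit points on a line, and both
  -- have strictly fewer face directions.
  suffices h : ∀ n, ∀ x, ∀ hx : x ∈ C, Module.finrank ℝ (faceDirections hC hx) < n →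
      x ∈ convexHull ℝ (C.extremePoints ℝ) from fun x hx => h _ x hx (Nat.lt_succ_self _)
  intro n
  induction n with
  | zero => intro x hx h; exact absurd h (Nat.not_lt_zero _)
  | succ n ih =>
    intro x hx hn
    by_cases hbot : faceDirections hC hx = ⊥
    · exact subset_convexHull _ _ (mem_extremePoints_of_faceDirections_eq_bot hC hx hbot)
    obtain ⟨d, hd, hd0⟩ := Submodule.exists_mem_ne_zero_of_ne_bot hbot
    obtain ⟨s, hs, hy, hdy⟩ := exists_exit_point hC hcomp hx hd hd0
    obtain ⟨r, hr, hw, hdw⟩ := exists_exit_point hC hcomp hx (neg_mem hd) (neg_ne_zero.2 hd0)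
    have hsum : r / (s + r) + s / (s + r) = 1 := by
      rw [← add_div, add_comm, div_self (by positivity)]
    have hxeq : x = (r / (s + r)) • (x + s • d) + (s / (s + r)) • (x + r • -d) := by
      have : (r / (s + r)) • (x + s • d) + (s / (s + r)) • (x + r • -d)
          = (r / (s + r) + s / (s + r)) • x +
            (r / (s + r) * s - s / (s + r) * r) • d := by module
      rw [this, hsum, one_smul, show r / (s + r) * s - s / (s + r) * r = 0 by ring, zero_smul,
        add_zero]
    have hyle := faceDirections_le hC hx hy hw (by positivity) (by positivity) hsum hxeq
    have hwle := faceDirections_le hC hx hw hy (a := s / (s + r)) (b := r / (s + r))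
      (by positivity) (by positivity) (by rw [add_comm]; exact hsum) (by rw [add_comm]; exact hxeq)
    have hylt : faceDirections hC hy < faceDirections hC hx :=
      lt_of_le_of_ne hyle fun h => hdy (h ▸ hd)
    have hwlt : faceDirections hC hw < faceDirections hC hx :=
      lt_of_le_of_ne hwle fun h => hdw (h ▸ neg_mem hd)
    have h1 := ih _ hy (by have := Submodule.finrank_lt_finrank_of_lt hylt; omega)
    have h2 := ih _ hw (by have := Submodule.finrank_lt_finrank_of_lt hwlt; omega)
    rw [hxeq]
    exact convex_convexHull ℝ _ h1 h2 (by positivity) (by positivity) hsum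

/-- Quantitative extremality: on the compact set of pairs at distance at least `ε`, the distance of
`a + b` from `2 • v` is continuous and never zero, so it has a positive minimum. -/
theorem exists_modulus_of_mem_extremePoints {C : Set E} (hcomp : IsCompact C) {v : E}
    (hv : v ∈ C.extremePoints ℝ) {ε : ℝ} (hε : 0 < ε) :
    ∃ δ > 0, ∀ a ∈ C, ∀ b ∈ C, ‖a + b - (2 : ℝ) • v‖ < δ → ‖a - b‖ < ε := by
  set K : Set (E × E) := (C ×ˢ C) ∩ {p | ε ≤ ‖p.1 - p.2‖} with hK
  have hKc : IsCompact K := (hcomp.prod hcomp).inter_right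
    (isClosed_le continuous_const (by fun_prop))
  rcases K.eq_empty_or_nonempty with h | h
  · refine ⟨1, one_pos, fun a ha b hb _ => ?_⟩
    by_contra! hab
    exact (h ▸ (⟨⟨ha, hb⟩, hab⟩ : (a, b) ∈ K) : (a, b) ∈ (∅ : Set (E × E)))
  · obtain ⟨p, hp, hmin⟩ := hKc.exists_isMinOn (f := fun p : E × E => ‖p.1 + p.2 - (2 : ℝ) • v‖) h
      (by fun_prop)
    refine ⟨‖p.1 + p.2 - (2 : ℝ) • v‖, ?_, fun a ha b hb hab => ?_⟩
    · rw [gt_iff_lt, norm_pos_iff, sub_ne_zero]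
      intro heq
      have hseg : v ∈ openSegment ℝ p.1 p.2 := by
        refine ⟨1 / 2, 1 / 2, by norm_num, by norm_num, by norm_num, ?_⟩
        rw [← smul_add, heq, smul_smul]
        norm_num
      obtain ⟨h1, h2⟩ := (mem_extremePoints.1 hv).2 _ hp.1.1 _ hp.1.2 hseg
      have h3 := hp.2
      simp only [mem_ofPred_eq, h1, h2, sub_self, norm_zero] at h3
      linarith
    · by_contra! hge
      have := hmin (⟨⟨ha, hb⟩, hge⟩ : (a, b) ∈ K)
      simp only [mem_ofPred_eq] at this
      linarith

end Minkowski

/-! ### Convexity and compactness of the set of integrals -/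

section Decomposable

variable {H : Type*} [MeasurableSpace H] {ι : Type*}

/-- A family of vector functions that is dominated by integrable functions, closed under gluing along
measurable sets, and closed under almost everywhere limits. -/
structure Decomposable (μ : Measure H) (S : Set (H → ι → ℝ)) : Prop where
  measurable : ∀ s ∈ S, ∀ i, Measurable fun x => s x i
  dominated : ∃ G : ι → H → ℝ, (∀ i, Integrable (G i) μ) ∧ ∀ s ∈ S, ∀ x i, |s x i| ≤ G i x
  glue : ∀ s ∈ S, ∀ s' ∈ S, ∀ E, MeasurableSet E →
    ∃ r ∈ S, (∀ x ∈ E, r x = s x) ∧ ∀ x ∉ E, r x = s' x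
  limit : ∀ s : ℕ → H → ι → ℝ, (∀ n, s n ∈ S) →
    (∀ᵐ x ∂μ, ∃ l, Tendsto (fun n => s n x) atTop (𝓝 l)) →
    ∃ r ∈ S, ∀ᵐ x ∂μ, Tendsto (fun n => s n x) atTop (𝓝 (r x))

/-- The set of integrals of the members of a family. -/
noncomputable def integrals (μ : Measure H) (S : Set (H → ι → ℝ)) : Set (ι → ℝ) :=
  (fun (s : H → ι → ℝ) (i : ι) => ∫ x, s x i ∂μ) '' S

namespace Decomposable

variable {μ : Measure H} {S : Set (H → ι → ℝ)}

theorem integrable (hS : Decomposable μ S) {s : H → ι → ℝ} (hs : s ∈ S) (i : ι) :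
    Integrable (fun x => s x i) μ := by
  obtain ⟨G, hG, hdom⟩ := hS.dominated
  exact (hG i).mono' (hS.measurable s hs i).aestronglyMeasurable
    (Eventually.of_forall fun x => hdom s hs x i)

theorem exists_glue (hS : Decomposable μ S) {s s' : H → ι → ℝ} (hs : s ∈ S) (hs' : s' ∈ S)
    {E : Set H} (hE : MeasurableSet E) :
    ∃ r ∈ S, ∀ i, ∫ x, r x i ∂μ = ∫ x in E, s x i ∂μ + ∫ x in Eᶜ, s' x i ∂μ := by
  obtain ⟨r, hr, h1, h2⟩ := hS.glue s hs s' hs' E hE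
  refine ⟨r, hr, fun i => ?_⟩
  rw [← integral_add_compl hE (hS.integrable hr i)]
  congr 1
  · exact setIntegral_congr_fun hE fun x hx => by simp only [h1 x hx]
  · exact setIntegral_congr_fun hE.compl fun x hx => by simp only [h2 x hx]

/-- Exchanging two members of the family on the set where one exceeds the other in coordinate `i`. -/
theorem exists_swap (hS : Decomposable μ S) {s s' : H → ι → ℝ} (hs : s ∈ S) (hs' : s' ∈ S) (i : ι) :
    ∃ a ∈ integrals μ S, ∃ b ∈ integrals μ S,
      (a + b = (fun j => ∫ x, s x j ∂μ) + fun j => ∫ x, s' x j ∂μ) ∧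
      a i - b i = ∫ x, |s x i - s' x i| ∂μ := by
  set E : Set H := {x | s' x i ≤ s x i} with hE_def
  have hE : MeasurableSet E := measurableSet_le (hS.measurable s' hs' i) (hS.measurable s hs i)
  obtain ⟨r, hr, hri⟩ := hS.exists_glue hs hs' hE
  -- `q` makes the opposite choice to `r` on each side, so the sum of the integrals is preserved
  -- while coordinate `i` separates as far as possible.
  obtain ⟨q, hq, hqi⟩ := hS.exists_glue hs' hs hE
  refine ⟨_, ⟨r, hr, rfl⟩, _, ⟨q, hq, rfl⟩, funext fun j => ?_, ?_⟩
  · simp only [Pi.add_apply, hri, hqi]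
    rw [← integral_add_compl hE (hS.integrable hs j), ← integral_add_compl hE (hS.integrable hs' j)]
    ring
  · have hI := (hS.integrable hs i).sub (hS.integrable hs' i)
    have h1 : ∫ x in E, |s x i - s' x i| ∂μ = ∫ x in E, (s x i - s' x i) ∂μ :=
      setIntegral_congr_fun hE fun x hx => abs_of_nonneg (sub_nonneg.2 hx)
    have h2 : ∫ x in Eᶜ, |s x i - s' x i| ∂μ = ∫ x in Eᶜ, (s' x i - s x i) ∂μ := by
      refine setIntegral_congr_fun hE.compl fun x hx => ?_
      have hx' : s x i < s' x i := not_le.1 hx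
      rw [abs_of_neg (sub_neg.2 hx'), neg_sub]
    simp only [hri, hqi]
    have h3 : ∫ x in E, |s x i - s' x i| ∂μ + ∫ x in Eᶜ, |s x i - s' x i| ∂μ =
      ∫ x, |s x i - s' x i| ∂μ := integral_add_compl hE hI.abs
    rw [← h3, h1, h2, integral_sub (hS.integrable hs i).integrableOn (hS.integrable hs' i).integrableOn,
      integral_sub (hS.integrable hs' i).integrableOn (hS.integrable hs i).integrableOn]
    ring

variable [Fintype ι]

/-- Lyapunov's theorem for the differences `s - s'` gives an event `E`; using `s` on `E` and `s'`
elsewhere realizes the convex combination. -/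
theorem convex_integrals [StandardBorelSpace H] [IsFiniteMeasure μ] [NullSingletonClass μ]
    (hS : Decomposable μ S) : Convex ℝ (integrals μ S) := by
  rintro _ ⟨s, hs, rfl⟩ _ ⟨s', hs', rfl⟩ a b ha hb hab
  obtain ⟨E, hE, h⟩ := exists_setIntegral_eq_mul (μ := μ)
    (f := fun i x => s x i - s' x i) (fun i => (hS.integrable hs i).sub (hS.integrable hs' i))
    (t := a) ⟨ha, by linarith⟩
  obtain ⟨r, hr, hri⟩ := hS.exists_glue hs hs' hE
  refine ⟨r, hr, funext fun i => ?_⟩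
  have h1 := h i
  rw [integral_sub (hS.integrable hs i).integrableOn (hS.integrable hs' i).integrableOn,
    integral_sub (hS.integrable hs i) (hS.integrable hs' i)] at h1
  have h2 := integral_add_compl hE (hS.integrable hs' i)
  simp only [hri i, Pi.add_apply, Pi.smul_apply, smul_eq_mul]
  rw [← eq_sub_iff_add_eq'] at hab
  rw [hab]
  linarith

theorem isBounded_integrals (hS : Decomposable μ S) : Bornology.IsBounded (integrals μ S) := by
  obtain ⟨G, hG, hdom⟩ := hS.dominated
  refine isBounded_iff_forall_norm_le.2 ⟨∑ i, |∫ x, G i x ∂μ|, ?_⟩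
  rintro _ ⟨s, hs, rfl⟩
  refine (pi_norm_le_iff_of_nonneg (Finset.sum_nonneg fun i _ => abs_nonneg _)).2 fun i => ?_
  have h1 : ‖∫ x, s x i ∂μ‖ ≤ ∫ x, G i x ∂μ :=
    norm_integral_le_of_norm_le (hG i) (Eventually.of_forall fun x => hdom s hs x i)
  exact (h1.trans (le_abs_self _)).trans
    (Finset.single_le_sum (f := fun i => |∫ x, G i x ∂μ|) (fun i _ => abs_nonneg _)
      (Finset.mem_univ i))

theorem extremePoints_closure_subset (hS : Decomposable μ S) :
    (closure (integrals μ S)).extremePoints ℝ ⊆ integrals μ S := by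
  intro v hv
  have hcomp : IsCompact (closure (integrals μ S)) := hS.isBounded_integrals.isCompact_closure
  obtain ⟨y, hy, hyv⟩ := mem_closure_iff_seq_limit.1 (extremePoints_subset hv)
  choose s hs hsy using hy
  choose δ hδ hmod using fun N : ℕ => exists_modulus_of_mem_extremePoints hcomp hv
    (ε := (1 / 2) ^ N) (by positivity)
  obtain ⟨φ, hφ, hclose⟩ := extraction_forall_of_eventually'
    (P := fun N k => ∀ n ≥ k, ‖y n - v‖ < δ N / 2) (fun N => by
      obtain ⟨k, hk⟩ := Metric.tendsto_atTop.1 hyv (δ N / 2) (by have := hδ N; positivity)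
      exact ⟨k, fun l hl n hn => by rw [← dist_eq_norm]; exact hk n (hl.trans hn)⟩)
  -- The swapped pair has midpoint near `v`, so extremality bounds `a i - b i`, which is exactly the
  -- L¹ distance in coordinate `i`.
  have hcau : ∀ i, ∀ N n m, N ≤ n → N ≤ m →
      eLpNorm ((fun x => s (φ n) x i) - fun x => s (φ m) x i) 1 μ <
        ENNReal.ofReal ((1 / 2) ^ N) := by
    intro i N n m hn hm
    obtain ⟨a, ha, b, hb, hab, habi⟩ := hS.exists_swap (hs (φ n)) (hs (φ m)) i
    have h1 : ‖a + b - (2 : ℝ) • v‖ < δ N := by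
      have h2 : a + b - (2 : ℝ) • v = (y (φ n) - v) + (y (φ m) - v) := by
        rw [hab, ← hsy, ← hsy, two_smul]
        abel
      rw [h2]
      have h3 := hclose N (φ n) (hφ.monotone hn)
      have h4 := hclose N (φ m) (hφ.monotone hm)
      have := norm_add_le (y (φ n) - v) (y (φ m) - v)
      linarith
    have h2 := hmod N a (subset_closure ha) b (subset_closure hb) h1
    have h3 : ∫ x, |s (φ n) x i - s (φ m) x i| ∂μ < (1 / 2) ^ N := by
      rw [← habi]
      exact ((le_abs_self _).trans (norm_le_pi_norm (a - b) i)).trans_lt h2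
    rw [eLpNorm_one_eq_lintegral_enorm, ← ofReal_integral_norm_eq_lintegral_enorm
      ((hS.integrable (hs (φ n)) i).sub (hS.integrable (hs (φ m)) i))]
    exact (ENNReal.ofReal_lt_ofReal_iff (by positivity)).2 h3
  -- The summable rate `(1 / 2) ^ N` upgrades L¹ Cauchy to almost everywhere convergence of the
  -- subsequence itself.
  have hsum : ∑' N : ℕ, ENNReal.ofReal ((1 / 2) ^ N) ≠ ⊤ :=
    (summable_geometric_two).tsum_ofReal_ne_top
  have hae : ∀ᵐ x ∂μ, ∃ l, Tendsto (fun n => s (φ n) x) atTop (𝓝 l) := by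
    have : ∀ᵐ x ∂μ, ∀ i, ∃ l, Tendsto (fun n => s (φ n) x i) atTop (𝓝 l) :=
      ae_all_iff.2 fun i => Lp.ae_tendsto_of_cauchy_eLpNorm
        (fun n => (hS.integrable (hs (φ n)) i).aestronglyMeasurable) le_rfl hsum (hcau i)
    filter_upwards [this] with x hx
    choose l hl using hx
    exact ⟨l, tendsto_pi_nhds.2 hl⟩
  obtain ⟨r, hr, hrlim⟩ := hS.limit (fun n => s (φ n)) (fun n => hs _) hae
  refine ⟨r, hr, funext fun i => ?_⟩
  obtain ⟨G, hG, hdom⟩ := hS.dominated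
  have hdct : Tendsto (fun n => ∫ x, s (φ n) x i ∂μ) atTop (𝓝 (∫ x, r x i ∂μ)) := by
    refine tendsto_integral_of_dominated_convergence (G i)
      (fun n => (hS.integrable (hs (φ n)) i).aestronglyMeasurable) (hG i)
      (fun n => Eventually.of_forall fun x => hdom _ (hs _) x i) ?_
    filter_upwards [hrlim] with x hx
    exact tendsto_pi_nhds.1 hx i
  refine tendsto_nhds_unique hdct ?_
  have := tendsto_pi_nhds.1 (hyv.comp hφ.tendsto_atTop) i
  refine this.congr fun n => ?_
  simp only [Function.comp_apply, ← hsy]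

theorem isCompact_integrals [StandardBorelSpace H] [IsFiniteMeasure μ] [NullSingletonClass μ]
    (hS : Decomposable μ S) : IsCompact (integrals μ S) := by
  have hcomp : IsCompact (closure (integrals μ S)) := hS.isBounded_integrals.isCompact_closure
  have h := convexHull_extremePoints_eq hS.convex_integrals.closure hcomp
  have hsub : closure (integrals μ S) ⊆ integrals μ S :=
    h ▸ convexHull_min hS.extremePoints_closure_subset hS.convex_integrals
  rwa [hsub.antisymm subset_closure] at hcomp

end Decomposable

end Decomposable

/-! ### Separation and Lagrange multipliers -/

section Duality

/-- Lagrangian duality for a compact convex set of pairs (objective, constraint slacks), without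
constraint qualification. -/
theorem exists_multiplier {κ : Type*} [Fintype κ] {A : Set (Option κ → ℝ)} (hA : IsCompact A)
    (hconv : Convex ℝ A) {r : ℝ} (hr : ∀ a ∈ A, (∀ i, 0 ≤ a (some i)) → a none < r) :
    ∃ l : κ → ℝ, (∀ i, 0 ≤ l i) ∧ ∀ a ∈ A, a none + ∑ i, l i * a (some i) ≤ r := by
  classical
  set Q : Set (Option κ → ℝ) := {b | r ≤ b none ∧ ∀ i, 0 ≤ b (some i)} with hQ
  have hQc : Convex ℝ Q := by
    rintro x ⟨hx, hx'⟩ y ⟨hy, hy'⟩ a b ha hb hab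
    refine ⟨?_, fun i => ?_⟩
    · simp only [Pi.add_apply, Pi.smul_apply, smul_eq_mul]
      calc r = a * r + b * r := by rw [← add_mul, hab, one_mul]
        _ ≤ _ := by gcongr
    · have h1 := hx' i
      have h2 := hy' i
      simp only [Pi.add_apply, Pi.smul_apply, smul_eq_mul]
      positivity
  have hQcl : IsClosed Q := by
    have : Q = {b | r ≤ b none} ∩ ⋂ i, {b | 0 ≤ b (some i)} := by
      ext b
      simp [hQ]
    rw [this]
    exact (isClosed_le continuous_const (continuous_apply _)).inter
      (isClosed_iInter fun i => isClosed_le continuous_const (continuous_apply _))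
  have hdisj : Disjoint A Q := by
    refine disjoint_left.2 ?_
    rintro a haA ⟨h1, h2⟩
    exact absurd (hr a haA h2) (not_lt.2 h1)
  obtain ⟨f, u, v, hfA, huv, hfQ⟩ := geometric_hahn_banach_compact_closed hconv hA hQc hQcl hdisj
  set c : Option κ → ℝ := fun j => f (Pi.single j 1) with hc
  have hf : ∀ a, f a = c none * a none + ∑ i, c (some i) * a (some i) := by
    intro a
    have h1 : a = ∑ j, a j • (Pi.single j (1 : ℝ) : Option κ → ℝ) := pi_eq_sum_univ' a
    conv_lhs => rw [h1]
    rw [map_sum, Fintype.sum_option]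
    simp only [map_smul, smul_eq_mul, hc, mul_comm]
  have hv0 : v < c none * r := by
    have := hfQ (Pi.single none r) ⟨by simp, fun i => by simp⟩
    rw [hf] at this
    simpa using this
  -- `Q` is closed under increasing any coordinate; a negative coefficient would let `f` drop to `v`
  -- on `Q`.
  have hcpos : ∀ j, 0 ≤ c j := by
    intro j
    by_contra! hneg
    set n : ℝ := (c none * r - v) / (-c j) with hn
    have hnpos : 0 ≤ n := div_nonneg (by linarith) (by linarith)
    have hmem : Pi.single none r + n • (Pi.single j (1 : ℝ) : Option κ → ℝ) ∈ Q := by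
      have hs : ∀ i, 0 ≤ (Pi.single j (1 : ℝ) : Option κ → ℝ) i := fun i => by
        rw [Pi.single_apply]
        split_ifs <;> norm_num
      refine ⟨?_, fun i => ?_⟩
      · have := mul_nonneg hnpos (hs none)
        simpa using this
      · have := mul_nonneg hnpos (hs (some i))
        simpa using this
    have h1 := hfQ _ hmem
    rw [map_add, map_smul, hf (Pi.single none r), smul_eq_mul] at h1
    have h2 : n * c j = -(c none * r - v) := by
      rw [hn, div_mul_eq_mul_div, div_eq_iff (by linarith)]
      ring
    simp only [Pi.single_eq_same, ne_eq, reduceCtorEq, not_false_eq_true, Pi.single_eq_of_ne,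
      mul_zero, Finset.sum_const_zero, add_zero] at h1
    change v < c none * r + n * c j at h1
    linarith
  rcases (hcpos none).lt_or_eq with h0 | h0
  · refine ⟨fun i => c (some i) / c none, fun i => div_nonneg (hcpos _) h0.le, fun a ha => ?_⟩
    have h1 : f a < c none * r := (hfA a ha).trans (huv.trans hv0)
    rw [hf] at h1
    refine le_of_mul_le_mul_left ?_ h0
    refine le_trans (le_of_eq ?_) h1.le
    rw [mul_add, Finset.mul_sum]
    congr 1
    refine Finset.sum_congr rfl fun i _ => ?_
    field_simp
  -- A vanishing objective coefficient means that no point of `A` is feasible. The constraint part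
  -- is then at most `u < 0`, and the scaling `n` makes it at most `-|B - r|`, which outweighs any
  -- objective value up to `B`.
  · rw [← h0, zero_mul] at hv0
    obtain ⟨B, hB⟩ := hA.isBounded.exists_norm_le
    have hu : u < 0 := huv.trans hv0
    set n : ℝ := |B - r| / (-u) with hn
    have hnpos : 0 ≤ n := div_nonneg (abs_nonneg _) (by linarith)
    refine ⟨fun i => n * c (some i), fun i => mul_nonneg hnpos (hcpos _), fun a ha => ?_⟩
    have h1 := (hfA a ha).le
    rw [hf, ← h0, zero_mul, zero_add] at h1
    have h2 : a none ≤ B := (le_abs_self _).trans ((norm_le_pi_norm a none).trans (hB a ha))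
    have h3 : n * u = -|B - r| := by
      rw [hn, div_mul_eq_mul_div, div_eq_iff (by linarith)]
      ring
    have h4 := mul_le_mul_of_nonneg_left h1 hnpos
    simp only [mul_assoc, ← Finset.mul_sum]
    linarith [le_abs_self (B - r)]

end Duality

/-! ### Measurable selection of convergent subsequences -/

section MeasurableSubsequence

variable {H : Type*} [MeasurableSpace H]

theorem frequently_dist_limsup_lt {y : ℕ → ℝ} {R : ℝ} (hy : ∀ n, |y n| ≤ R) {ε : ℝ} (hε : 0 < ε) :
    ∃ᶠ n in atTop, |y n - limsup y atTop| < ε := by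
  have hb : IsBoundedUnder (· ≤ ·) atTop y := isBoundedUnder_of ⟨R, fun n => (abs_le.1 (hy n)).2⟩
  have hb' : IsBoundedUnder (· ≥ ·) atTop y := isBoundedUnder_of ⟨-R, fun n => (abs_le.1 (hy n)).1⟩
  have h1 : ∀ᶠ n in atTop, y n < limsup y atTop + ε :=
    eventually_lt_of_limsup_lt (by linarith) hb
  have h2 : ∃ᶠ n in atTop, limsup y atTop - ε < y n :=
    frequently_lt_of_lt_limsup hb'.isCoboundedUnder_le (by linarith)
  exact (h2.and_eventually h1).mono fun n hn => abs_lt.2 ⟨by linarith [hn.1], by linarith [hn.2]⟩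

/-- The limsup is measurable and is approached infinitely often; choosing the first later index
within `(1 / 2) ^ n` of it is a measurable choice. -/
theorem exists_measurable_subseq_real {y : ℕ → H → ℝ} (hm : ∀ n, Measurable (y n))
    (hb : ∀ x, ∃ R, ∀ n, |y n x| ≤ R) :
    ∃ φ : ℕ → H → ℕ, (∀ n, Measurable (φ n)) ∧ (∀ x, StrictMono fun n => φ n x) ∧
      ∃ L : H → ℝ, Measurable L ∧ ∀ x, Tendsto (fun n => y (φ n x) x) atTop (𝓝 (L x)) := by
  classical
  set L : H → ℝ := fun x => limsup (fun n => y n x) atTop with hL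
  have hLm : Measurable L := Measurable.limsup hm
  have step : ∀ (ε : ℝ), 0 < ε → ∀ a : H → ℕ, Measurable a → ∃ b : H → ℕ, Measurable b ∧
      ∀ x, a x < b x ∧ |y (b x) x - L x| < ε := by
    intro ε hε a ha
    have hex : ∀ x, ∃ n, a x < n ∧ |y n x - L x| < ε := by
      intro x
      obtain ⟨R, hR⟩ := hb x
      obtain ⟨n, hn, hn'⟩ := frequently_atTop.1 (frequently_dist_limsup_lt hR hε) (a x + 1)
      exact ⟨n, hn, hn'⟩
    refine ⟨fun x => Nat.find (hex x), measurable_find hex fun k => ?_,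
      fun x => Nat.find_spec (hex x)⟩
    exact (measurableSet_lt ha measurable_const).inter
      (measurableSet_lt (((hm k).sub hLm).abs) measurable_const)
  choose! nxt hnxt hnxt' using step
  set φ : ℕ → H → ℕ := fun n => Nat.rec (fun _ => 0) (fun n a => nxt ((1 / 2) ^ n) a) n with hφ
  have hφs : ∀ n, φ (n + 1) = nxt ((1 / 2) ^ n) (φ n) := fun n => rfl
  have hφm : ∀ n, Measurable (φ n) := by
    intro n
    induction n with
    | zero => exact measurable_const
    | succ n ih => rw [hφs]; exact hnxt _ (by positivity) _ ih
  have hspec : ∀ n x, φ n x < φ (n + 1) x ∧ |y (φ (n + 1) x) x - L x| < (1 / 2) ^ n := by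
    intro n x
    rw [hφs]
    exact hnxt' _ (by positivity) _ (hφm n) x
  refine ⟨φ, hφm, fun x => strictMono_nat_of_lt_succ fun n => (hspec n x).1, L, hLm, fun x => ?_⟩
  rw [← tendsto_add_atTop_iff_nat 1]
  have h0 : Tendsto (fun n : ℕ => (1 / 2 : ℝ) ^ n) atTop (𝓝 0) :=
    tendsto_pow_atTop_nhds_zero_of_lt_one (by norm_num) (by norm_num)
  rw [tendsto_iff_dist_tendsto_zero]
  exact squeeze_zero (fun _ => dist_nonneg) (fun n => (hspec n x).2.le) h0

/-- **Measurable Bolzano–Weierstrass theorem**. -/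
theorem exists_measurable_subseq {ι : Type*} [Finite ι] {y : ℕ → H → ι → ℝ}
    (hm : ∀ n i, Measurable fun x => y n x i) (hb : ∀ x i, ∃ R, ∀ n, |y n x i| ≤ R) :
    ∃ L : H → ι → ℝ, (∀ i, Measurable fun x => L x i) ∧ ∀ x, ∃ φ : ℕ → ℕ, StrictMono φ ∧
      ∀ i, Tendsto (fun n => y (φ n) x i) atTop (𝓝 (L x i)) := by
  suffices h : ∀ s : Set ι, s.Finite → ∃ φ : ℕ → H → ℕ, (∀ n, Measurable (φ n)) ∧
      (∀ x, StrictMono fun n => φ n x) ∧ ∀ i ∈ s, ∃ L : H → ℝ, Measurable L ∧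
        ∀ x, Tendsto (fun n => y (φ n x) x i) atTop (𝓝 (L x)) by
    obtain ⟨φ, -, hmono, hL⟩ := h univ finite_univ
    choose L hLm hL using fun i => hL i (mem_univ i)
    exact ⟨fun x i => L i x, hLm, fun x => ⟨fun n => φ n x, hmono x, fun i => hL i x⟩⟩
  intro s hs
  induction s, hs using Set.Finite.induction_on with
  | empty => exact ⟨fun n _ => n, fun n => measurable_const, fun x => strictMono_id, by simp⟩
  | @insert i s _ _ ih =>
    obtain ⟨φ, hφm, hφ, hL⟩ := ih
    -- Evaluation at a random index is measurable because the index set is countable.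
    have hcomp : ∀ (a : H → ℕ), Measurable a → ∀ z : ℕ → H → ℝ, (∀ n, Measurable (z n)) →
        Measurable fun x => z (a x) x := fun a ha z hz =>
      (measurable_from_prod_countable_left (f := fun p : H × ℕ => z p.2 p.1) hz).comp
        (measurable_id.prodMk ha)
    obtain ⟨ψ, hψm, hψ, L, hLm, hψL⟩ := exists_measurable_subseq_real
      (y := fun n x => y (φ n x) x i) (fun n => hcomp _ (hφm n) _ fun k => hm k i)
      (fun x => (hb x i).imp fun R hR n => hR _)
    refine ⟨fun n x => φ (ψ n x) x, fun n => ?_, fun x => (hφ x).comp (hψ x), ?_⟩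
    · exact (measurable_from_prod_countable_left (f := fun p : H × ℕ => φ p.2 p.1) hφm).comp
        (measurable_id.prodMk (hψm n))
    · rintro j (rfl | hj)
      · exact ⟨L, hLm, hψL⟩
      · obtain ⟨L', hL'm, hL'⟩ := hL j hj
        exact ⟨L', hL'm, fun x => (hL' x).comp (hψ x).tendsto_atTop⟩

end MeasurableSubsequence

/-! ### Monotonicity, continuity and measurability of the rates -/

section Rates

theorem suRate_nonneg {x : ℝ} (hx : 0 ≤ x) : 0 ≤ suRate x :=
  Real.logb_nonneg one_lt_two (by linarith)

theorem suRate_le {x y : ℝ} (hx : 0 ≤ x) (hxy : x ≤ y) : suRate x ≤ suRate y :=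
  Real.logb_le_logb_of_le one_lt_two (by linarith) (by linarith)

theorem puRate_nonneg {γ x : ℝ} (hγ : 0 ≤ γ) (hx : 0 ≤ x) : 0 ≤ puRate γ x :=
  Real.logb_nonneg one_lt_two (le_add_of_nonneg_right (by positivity))

theorem puRate_le {γ x : ℝ} (hγ : 0 ≤ γ) (hx : 0 ≤ x) : puRate γ x ≤ puRate γ 0 := by
  refine Real.logb_le_logb_of_le one_lt_two (by positivity) ?_
  rw [add_zero]
  gcongr
  linarith

theorem continuousAt_suRate {x : ℝ} (hx : 0 ≤ x) : ContinuousAt suRate x :=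
  ((continuousAt_const.add continuousAt_id).log (add_pos_of_pos_of_nonneg one_pos hx).ne').div_const _

theorem continuousAt_puRate {γ x : ℝ} (hγ : 0 ≤ γ) (hx : 0 ≤ x) : ContinuousAt (puRate γ) x := by
  have h : 1 + x ≠ 0 := by positivity
  have h1 : ContinuousAt (fun x : ℝ => 1 + x) x := continuousAt_const.add continuousAt_id
  have h2 : 1 + γ / (1 + x) ≠ 0 := by positivity
  exact ((continuousAt_const.add (continuousAt_const.div h1 h)).log h2).div_const _

theorem measurable_suRate : Measurable suRate :=
  (Real.measurable_log.comp (measurable_const.add measurable_id)).div_const _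

theorem measurable_puRate (γ : ℝ) : Measurable (puRate γ) :=
  (Real.measurable_log.comp
    (measurable_const.add (measurable_const.div (measurable_const.add measurable_id)))).div_const _

end Rates

/-! ### Channel gains and conditioning on primary activity -/

section Channel

variable {M K : ℕ}

theorem CSI.activity_nonneg (h : CSI M K) (k : Fin K) : 0 ≤ h.activity k := by
  unfold CSI.activity
  split_ifs <;> norm_num

theorem CSI.activity_le_one (h : CSI M K) (k : Fin K) : h.activity k ≤ 1 := by
  unfold CSI.activity
  split_ifs <;> norm_num

theorem CSI.gainPU_nonneg (h : CSI M K) (m : Fin M) (k : Fin K) : 0 ≤ h.gainPU m k :=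
  NNReal.coe_nonneg _

theorem CSI.gainSU_nonneg (h : CSI M K) (m : Fin M) (k : Fin K) : 0 ≤ h.gainSU m k :=
  NNReal.coe_nonneg _

theorem measurableSet_activeEvent (k : Fin K) : MeasurableSet (activeEvent M k) :=
  measurableSet_eq_fun ((measurable_pi_apply k).comp measurable_fst) measurable_const

theorem measurable_activity (k : Fin K) : Measurable fun h : CSI M K => h.activity k :=
  Measurable.ite (measurableSet_activeEvent k) measurable_const measurable_const

theorem measurable_gainPU (m : Fin M) (k : Fin K) : Measurable fun h : CSI M K => h.gainPU m k := by
  unfold CSI.gainPU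
  fun_prop

theorem measurable_gainSU (m : Fin M) (k : Fin K) : Measurable fun h : CSI M K => h.gainSU m k := by
  unfold CSI.gainSU
  fun_prop

theorem activity_mul_eq_indicator (k : Fin K) (f : CSI M K → ℝ) :
    (fun h : CSI M K => h.activity k * f h) = (activeEvent M k).indicator f := by
  funext h
  by_cases hk : h.1 k = true <;> simp [CSI.activity, activeEvent, indicator, hk]

/-- Weighting by `a_k` only rescales the conditional expectation by the probability of activity,
which is positive here, so the dualized constraint has the sign of the conditional one. -/
theorem integral_activity_mul_sub {μ : Measure (CSI M K)} [IsFiniteMeasure μ] {k : Fin K}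
    (hk : μ (activeEvent M k) ≠ 0) {f : CSI M K → ℝ} {c : ℝ}
    (hf : Integrable (fun h : CSI M K => h.activity k * (f h - c)) μ) :
    ∫ h, h.activity k * (f h - c) ∂μ = μ.real (activeEvent M k) *
      (∫ h, f h ∂(ProbabilityTheory.cond μ (activeEvent M k)) - c) := by
  have hE := measurableSet_activeEvent (M := M) k
  have hprob := ProbabilityTheory.cond_isProbabilityMeasure hk
  rw [activity_mul_eq_indicator k fun h => f h - c] at hf ⊢
  have hint : Integrable (fun h => f h - c) (ProbabilityTheory.cond μ (activeEvent M k)) :=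
    ((integrable_indicator_iff hE).1 hf).smul_measure (ENNReal.inv_ne_top.2 hk)
  have hint' : Integrable f (ProbabilityTheory.cond μ (activeEvent M k)) := by
    simpa [Pi.add_def] using hint.add (integrable_const c)
  have h1 : ∫ h, (f h - c) ∂(ProbabilityTheory.cond μ (activeEvent M k)) =
      (μ.real (activeEvent M k))⁻¹ * ∫ h in activeEvent M k, (f h - c) ∂μ := by
    rw [ProbabilityTheory.cond, integral_smul_measure, ENNReal.toReal_inv, smul_eq_mul]
    rfl
  rw [integral_sub hint' (integrable_const c)] at h1
  simp only [integral_const, probReal_univ, smul_eq_mul, one_mul] at h1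
  rw [h1, integral_indicator hE, mul_inv_cancel_left₀]
  exact (measureReal_ne_zero_iff).2 hk

theorem integral_activity_mul_of_null {μ : Measure (CSI M K)} {k : Fin K}
    (hk : μ (activeEvent M k) = 0) (f : CSI M K → ℝ) :
    ∫ h, h.activity k * f h ∂μ = 0 := by
  rw [activity_mul_eq_indicator k f, integral_indicator (measurableSet_activeEvent k),
    setIntegral_measure_zero _ hk]

end Channel

/-! ### Policies as a decomposable family -/

namespace Policy

variable {M K : ℕ} {P : Params M K} {z : Policy M K}

/-- The integrands of the objective (`none`) and of the slacks of the long-term constraints. -/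
noncomputable def slack (P : Params M K) (z : Policy M K) (h : CSI M K) :
    Option (Fin M ⊕ Fin K ⊕ Fin K) → ℝ
  | none => ∑ k : Fin K, ∑ m : Fin M,
      P.weight m * z.sched (some m) k h * suRate (h.gainSU m k * z.power m k h)
  | some (Sum.inl m) => P.powerLimit m - z.txPower m h
  | some (Sum.inr (Sum.inl k)) => h.activity k * (P.interfLimit k - z.interference k h)
  | some (Sum.inr (Sum.inr k)) => h.activity k * (z.primaryRate P k h - P.rateMin k)

namespace ShortTerm

theorem sched_nonneg (hz : z.ShortTerm P) (m k h) : 0 ≤ z.sched m k h := by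
  rcases hz.binary m k h with h | h <;> rw [h]
  norm_num

theorem sched_le_one (hz : z.ShortTerm P) (m k h) : z.sched m k h ≤ 1 := by
  rcases hz.binary m k h with h | h <;> rw [h]
  norm_num

theorem measurable_utility (hz : z.ShortTerm P) (m : Fin M) (k : Fin K) : Measurable fun h =>
    P.weight m * z.sched (some m) k h * suRate (h.gainSU m k * z.power m k h) :=
  ((hz.measurable_sched _ k).const_mul _).mul
    (measurable_suRate.comp ((measurable_gainSU m k).mul (hz.measurable_power m k)))

theorem measurable_slack (hz : z.ShortTerm P) (i) : Measurable fun h => slack P z h i := by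
  match i with
  | none =>
    exact Finset.measurable_sum _ fun k _ => Finset.measurable_sum _ fun m _ =>
      hz.measurable_utility m k
  | some (Sum.inl m) =>
    exact measurable_const.sub (Finset.measurable_sum _ fun k _ =>
      (hz.measurable_sched _ _).mul (hz.measurable_power m k))
  | some (Sum.inr (Sum.inl k)) =>
    exact (measurable_activity k).mul (measurable_const.sub (Finset.measurable_sum _ fun m _ =>
      (hz.measurable_sched _ _).mul ((measurable_gainPU m k).mul (hz.measurable_power m k))))
  | some (Sum.inr (Sum.inr k)) =>
    exact (measurable_activity k).mul ((((hz.measurable_sched _ _).mul_const _).add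
      (Finset.measurable_sum _ fun m _ => (hz.measurable_sched _ _).mul
        ((measurable_puRate _).comp ((measurable_gainPU m k).mul
          (hz.measurable_power m k))))).sub_const _)

theorem utility_nonneg (hz : z.ShortTerm P) (hweight : ∀ m, 0 < P.weight m) (m : Fin M)
    (k : Fin K) (h : CSI M K) :
    0 ≤ P.weight m * z.sched (some m) k h * suRate (h.gainSU m k * z.power m k h) :=
  mul_nonneg (mul_nonneg (hweight m).le (hz.sched_nonneg _ _ _))
    (suRate_nonneg (mul_nonneg (h.gainSU_nonneg m k) (hz.power_nonneg m k h)))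

theorem utility_le (hz : z.ShortTerm P) (hweight : ∀ m, 0 < P.weight m) (m : Fin M) (k : Fin K)
    (h : CSI M K) :
    P.weight m * z.sched (some m) k h * suRate (h.gainSU m k * z.power m k h) ≤
      P.weight m * suRate (h.gainSU m k * P.peak m k h) := by
  have h0 := mul_nonneg (h.gainSU_nonneg m k) (hz.power_nonneg m k h)
  have h1 : suRate (h.gainSU m k * z.power m k h) ≤ suRate (h.gainSU m k * P.peak m k h) :=
    suRate_le h0 (mul_le_mul_of_nonneg_left (hz.power_le_peak m k h) (h.gainSU_nonneg m k))
  refine mul_le_mul ?_ h1 (suRate_nonneg h0) (hweight m).le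
  exact mul_le_of_le_one_right (hweight m).le (hz.sched_le_one _ _ _)

theorem integrable_utility {μ : Measure (CSI M K)} (hz : z.ShortTerm P)
    (hweight : ∀ m, 0 < P.weight m)
    (hpeak_rate : ∀ m k, Integrable
      (fun h : CSI M K => suRate (h.gainSU m k * P.peak m k h)) μ) (m : Fin M) (k : Fin K) :
    Integrable (fun h =>
      P.weight m * z.sched (some m) k h * suRate (h.gainSU m k * z.power m k h)) μ :=
  ((hpeak_rate m k).const_mul (P.weight m)).mono' (hz.measurable_utility m k).aestronglyMeasurable
    (Eventually.of_forall fun h => by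
      rw [Real.norm_of_nonneg (hz.utility_nonneg hweight m k h)]
      exact hz.utility_le hweight m k h)

end ShortTerm

/-- An upper bound for the absolute values of `slack` over all admissible policies. -/
noncomputable def slackBound (P : Params M K) : Option (Fin M ⊕ Fin K ⊕ Fin K) → CSI M K → ℝ
  | none, h => ∑ k : Fin K, ∑ m : Fin M, P.weight m * suRate (h.gainSU m k * P.peak m k h)
  | some (Sum.inl m), h => |P.powerLimit m| + ∑ k : Fin K, P.peak m k h
  | some (Sum.inr (Sum.inl k)), h =>
      |P.interfLimit k| + ∑ m : Fin M, h.activity k * (h.gainPU m k * P.peak m k h)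
  | some (Sum.inr (Sum.inr k)), _ =>
      puRate (P.snr k) 0 + ∑ _m : Fin M, puRate (P.snr k) 0 + |P.rateMin k|

theorem ShortTerm.abs_slack_le (hz : z.ShortTerm P) (hweight : ∀ m, 0 < P.weight m)
    (hsnr : ∀ k, 0 ≤ P.snr k) (h : CSI M K) (i) : |slack P z h i| ≤ slackBound P i h := by
  have hsp : ∀ m k, z.sched (some m) k h * z.power m k h ≤ P.peak m k h := fun m k =>
    (mul_le_of_le_one_left (hz.power_nonneg m k h) (hz.sched_le_one _ k h)).trans
      (hz.power_le_peak m k h)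
  match i with
  | none =>
    simp only [slack, slackBound]
    rw [abs_of_nonneg (Finset.sum_nonneg fun k _ => Finset.sum_nonneg fun m _ =>
      hz.utility_nonneg hweight m k h)]
    exact Finset.sum_le_sum fun k _ => Finset.sum_le_sum fun m _ => hz.utility_le hweight m k h
  | some (Sum.inl m) =>
    simp only [slack, slackBound]
    refine (abs_sub _ _).trans (add_le_add le_rfl ?_)
    rw [txPower, abs_of_nonneg (Finset.sum_nonneg fun k _ =>
      mul_nonneg (hz.sched_nonneg _ _ _) (hz.power_nonneg m k h))]
    exact Finset.sum_le_sum fun k _ => hsp m k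
  | some (Sum.inr (Sum.inl k)) =>
    simp only [slack, slackBound]
    have h0 : 0 ≤ z.interference k h := Finset.sum_nonneg fun m _ =>
      mul_nonneg (hz.sched_nonneg _ _ _) (mul_nonneg (h.gainPU_nonneg m k) (hz.power_nonneg m k h))
    rw [mul_sub]
    refine (abs_sub _ _).trans (add_le_add ?_ ?_)
    · rw [abs_mul, abs_of_nonneg (h.activity_nonneg k)]
      exact mul_le_of_le_one_left (abs_nonneg _) (h.activity_le_one k)
    · rw [abs_of_nonneg (mul_nonneg (h.activity_nonneg k) h0), interference, Finset.mul_sum]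
      refine Finset.sum_le_sum fun m _ => mul_le_mul_of_nonneg_left ?_ (h.activity_nonneg k)
      rw [mul_left_comm]
      exact mul_le_mul_of_nonneg_left (hsp m k) (h.gainPU_nonneg m k)
  | some (Sum.inr (Sum.inr k)) =>
    simp only [slack, slackBound]
    have hx : ∀ m, 0 ≤ h.gainPU m k * z.power m k h := fun m =>
      mul_nonneg (h.gainPU_nonneg m k) (hz.power_nonneg m k h)
    have h0 : 0 ≤ z.primaryRate P k h := add_nonneg
      (mul_nonneg (hz.sched_nonneg _ _ _) (puRate_nonneg (hsnr k) le_rfl))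
      (Finset.sum_nonneg fun m _ =>
        mul_nonneg (hz.sched_nonneg _ _ _) (puRate_nonneg (hsnr k) (hx m)))
    rw [abs_mul, abs_of_nonneg (h.activity_nonneg k)]
    refine (mul_le_of_le_one_left (abs_nonneg _) (h.activity_le_one k)).trans ?_
    refine (abs_sub _ _).trans (add_le_add ?_ le_rfl)
    rw [abs_of_nonneg h0, primaryRate]
    refine add_le_add ?_ (Finset.sum_le_sum fun m _ => ?_)
    · exact mul_le_of_le_one_left (puRate_nonneg (hsnr k) le_rfl) (hz.sched_le_one _ _ _)
    · exact (mul_le_of_le_one_left (puRate_nonneg (hsnr k) (hx m)) (hz.sched_le_one _ _ _)).trans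
        (puRate_le (hsnr k) (hx m))

/-- Nonnegative limiting powers keep the arguments of both rates where they are continuous. -/
theorem tendsto_slack (hsnr : ∀ k, 0 ≤ P.snr k) (h : CSI M K) {y : ℕ → Policy M K}
    (hz : ∀ m k, 0 ≤ z.power m k h)
    (hsched : ∀ m k, Tendsto (fun n => (y n).sched m k h) atTop (𝓝 (z.sched m k h)))
    (hpower : ∀ m k, Tendsto (fun n => (y n).power m k h) atTop (𝓝 (z.power m k h))) :
    Tendsto (fun n => slack P (y n) h) atTop (𝓝 (slack P z h)) := by
  refine tendsto_pi_nhds.2 fun i => ?_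
  match i with
  | none =>
    refine tendsto_finsetSum _ fun k _ => tendsto_finsetSum _ fun m _ => ?_
    exact ((hsched _ k).const_mul _).mul ((continuousAt_suRate
      (mul_nonneg (h.gainSU_nonneg m k) (hz m k))).tendsto.comp ((hpower m k).const_mul _))
  | some (Sum.inl m) =>
    exact (tendsto_finsetSum _ fun k _ => (hsched _ k).mul (hpower m k)).const_sub _
  | some (Sum.inr (Sum.inl k)) =>
    exact ((tendsto_finsetSum _ fun m _ =>
      (hsched _ k).mul ((hpower m k).const_mul _)).const_sub _).const_mul _
  | some (Sum.inr (Sum.inr k)) =>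
    refine ((((hsched _ k).mul_const _).add (tendsto_finsetSum _ fun m _ => ?_)).sub_const
      _).const_mul _
    exact (hsched _ k).mul ((continuousAt_puRate (hsnr k)
      (mul_nonneg (h.gainPU_nonneg m k) (hz m k))).tendsto.comp ((hpower m k).const_mul _))

open Classical in
/-- The policy that follows `z` on `E` and `y` elsewhere. -/
noncomputable def glue (E : Set (CSI M K)) (z y : Policy M K) : Policy M K where
  sched m k := E.piecewise (z.sched m k) (y.sched m k)
  power m k := E.piecewise (z.power m k) (y.power m k)

theorem glue_apply_mem {E : Set (CSI M K)} {h : CSI M K} (hh : h ∈ E) (z y : Policy M K) :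
    (∀ m k, (glue E z y).sched m k h = z.sched m k h) ∧
      ∀ m k, (glue E z y).power m k h = z.power m k h := by
  simp [glue, hh]

theorem glue_apply_notMem {E : Set (CSI M K)} {h : CSI M K} (hh : h ∉ E) (z y : Policy M K) :
    (∀ m k, (glue E z y).sched m k h = y.sched m k h) ∧
      ∀ m k, (glue E z y).power m k h = y.power m k h := by
  simp [glue, hh]

theorem slack_congr {y : Policy M K} {h : CSI M K}
    (hs : ∀ m k, z.sched m k h = y.sched m k h) (hp : ∀ m k, z.power m k h = y.power m k h) :
    slack P z h = slack P y h := by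
  funext i
  rcases i with _ | m | k | k <;>
    simp only [slack, txPower, interference, primaryRate, hs, hp]

theorem ShortTerm.glue {y : Policy M K} (hz : z.ShortTerm P) (hy : y.ShortTerm P)
    {E : Set (CSI M K)} (hE : MeasurableSet E) : (Policy.glue E z y).ShortTerm P where
  measurable_sched m k := (hz.measurable_sched m k).piecewise hE (hy.measurable_sched m k)
  measurable_power m k := (hz.measurable_power m k).piecewise hE (hy.measurable_power m k)
  binary m k h := by
    by_cases hh : h ∈ E
    · rw [(glue_apply_mem hh z y).1]; exact hz.binary m k h
    · rw [(glue_apply_notMem hh z y).1]; exact hy.binary m k h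
  orthogonal k h := by
    by_cases hh : h ∈ E
    · simp only [(glue_apply_mem hh z y).1]; exact hz.orthogonal k h
    · simp only [(glue_apply_notMem hh z y).1]; exact hy.orthogonal k h
  power_nonneg m k h := by
    by_cases hh : h ∈ E
    · rw [(glue_apply_mem hh z y).2]; exact hz.power_nonneg m k h
    · rw [(glue_apply_notMem hh z y).2]; exact hy.power_nonneg m k h
  power_le_peak m k h := by
    by_cases hh : h ∈ E
    · rw [(glue_apply_mem hh z y).2]; exact hz.power_le_peak m k h
    · rw [(glue_apply_notMem hh z y).2]; exact hy.power_le_peak m k h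

/-- A sequence of admissible policies has an admissible policy among its pointwise cluster points. -/
theorem exists_cluster_policy {y : ℕ → Policy M K} (hy : ∀ n, (y n).ShortTerm P) :
    ∃ z : Policy M K, z.ShortTerm P ∧ ∀ h, ∃ φ : ℕ → ℕ, StrictMono φ ∧
      (∀ m k, Tendsto (fun n => (y (φ n)).sched m k h) atTop (𝓝 (z.sched m k h))) ∧
      ∀ m k, Tendsto (fun n => (y (φ n)).power m k h) atTop (𝓝 (z.power m k h)) := by
  obtain ⟨L, hLm, hL⟩ := exists_measurable_subseq
    (ι := (Option (Fin M) × Fin K) ⊕ (Fin M × Fin K))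
    (y := fun n h => Sum.elim (fun p => (y n).sched p.1 p.2 h) fun p => (y n).power p.1 p.2 h)
    (by
      rintro n (p | p)
      · exact (hy n).measurable_sched p.1 p.2
      · exact (hy n).measurable_power p.1 p.2)
    (by
      rintro h (p | p)
      · refine ⟨1, fun n => ?_⟩
        simp only [Sum.elim_inl]
        rw [abs_of_nonneg ((hy n).sched_nonneg _ _ _)]
        exact (hy n).sched_le_one _ _ _
      · refine ⟨P.peak p.1 p.2 h, fun n => ?_⟩
        simp only [Sum.elim_inr]
        rw [abs_of_nonneg ((hy n).power_nonneg _ _ _)]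
        exact (hy n).power_le_peak _ _ _)
  choose φ hφ hlim using hL
  have hs : ∀ h m k, Tendsto (fun n => (y (φ h n)).sched m k h) atTop (𝓝 (L h (Sum.inl (m, k)))) :=
    fun h m k => hlim h (Sum.inl (m, k))
  have hp : ∀ h m k, Tendsto (fun n => (y (φ h n)).power m k h) atTop (𝓝 (L h (Sum.inr (m, k)))) :=
    fun h m k => hlim h (Sum.inr (m, k))
  refine ⟨⟨fun m k h => L h (Sum.inl (m, k)), fun m k h => L h (Sum.inr (m, k))⟩,
    ⟨fun m k => hLm _, fun m k => hLm _, fun m k h => ?_, fun k h => ?_, fun m k h => ?_,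
      fun m k h => ?_⟩, fun h => ⟨φ h, hφ h, hs h, hp h⟩⟩
  -- Binary scheduling survives the limit because `{0, 1}` is closed, so no relaxation is needed.
  · have hcl : IsClosed ({0, 1} : Set ℝ) := (toFinite _).isClosed
    exact hcl.mem_of_tendsto (hs h m k) (Eventually.of_forall fun n => (hy _).binary m k h)
  · refine tendsto_nhds_unique (tendsto_finsetSum _ fun m _ => hs h m k) ?_
    simp only [(hy _).orthogonal k h]
    exact tendsto_const_nhds
  · exact ge_of_tendsto' (hp h m k) fun n => (hy _).power_nonneg m k h
  · exact le_of_tendsto' (hp h m k) fun n => (hy _).power_le_peak m k h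

theorem decomposable_slack {μ : Measure (CSI M K)} [IsFiniteMeasure μ]
    (hweight : ∀ m, 0 < P.weight m) (hsnr : ∀ k, 0 ≤ P.snr k)
    (hpeak_power : ∀ m k, Integrable (P.peak m k) μ)
    (hpeak_interf : ∀ m k, Integrable
      (fun h : CSI M K => h.activity k * (h.gainPU m k * P.peak m k h)) μ)
    (hpeak_rate : ∀ m k, Integrable
      (fun h : CSI M K => suRate (h.gainSU m k * P.peak m k h)) μ) :
    Decomposable μ (slack P '' {z | z.ShortTerm P}) where
  measurable := by
    rintro _ ⟨z, hz, rfl⟩ i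
    exact hz.measurable_slack i
  dominated := by
    refine ⟨slackBound P, fun i => ?_, ?_⟩
    · match i with
      | none =>
        exact integrable_finsetSum _ fun k _ => integrable_finsetSum _ fun m _ =>
          (hpeak_rate m k).const_mul _
      | some (Sum.inl m) =>
        exact (integrable_const _).add (integrable_finsetSum _ fun k _ => hpeak_power m k)
      | some (Sum.inr (Sum.inl k)) =>
        exact (integrable_const _).add (integrable_finsetSum _ fun m _ => hpeak_interf m k)
      | some (Sum.inr (Sum.inr k)) => exact integrable_const _
    · rintro _ ⟨z, hz, rfl⟩ h i
      exact hz.abs_slack_le hweight hsnr h i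
  glue := by
    rintro _ ⟨z, hz, rfl⟩ _ ⟨y, hy, rfl⟩ E hE
    refine ⟨_, ⟨_, hz.glue hy hE, rfl⟩, fun h hh => ?_, fun h hh => ?_⟩
    · exact slack_congr (glue_apply_mem hh z y).1 (glue_apply_mem hh z y).2
    · exact slack_congr (glue_apply_notMem hh z y).1 (glue_apply_notMem hh z y).2
  limit := by
    intro s hs hlim
    choose y hy hys using hs
    obtain ⟨z, hz, hcl⟩ := exists_cluster_policy hy
    refine ⟨_, ⟨z, hz, rfl⟩, ?_⟩
    filter_upwards [hlim] with h hl
    obtain ⟨l, hl⟩ := hl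
    obtain ⟨φ, hφ, h1, h2⟩ := hcl h
    have h3 := tendsto_slack hsnr h (y := fun n => y (φ n))
      (fun m k => hz.power_nonneg m k h) h1 h2
    -- The policies themselves need not converge, but their slacks do; hence the slack of any
    -- cluster policy is the limit.
    have h4 : Tendsto (fun n => slack P (y (φ n)) h) atTop (𝓝 l) := by
      simpa only [hys, Function.comp_def] using hl.comp hφ.tendsto_atTop
    rwa [tendsto_nhds_unique h3 h4]

theorem longTerm_iff {μ : Measure (CSI M K)} [IsProbabilityMeasure μ]
    (hint : ∀ i, Integrable (fun h => slack P z h i) μ) :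
    z.LongTerm P μ ↔ ∀ i, 0 ≤ ∫ h, slack P z h (some i) ∂μ := by
  have hpow : ∀ m, ∫ h, slack P z h (some (Sum.inl m)) ∂μ =
      P.powerLimit m - ∫ h, z.txPower m h ∂μ := by
    intro m
    have h1 : Integrable (fun h => P.powerLimit m - z.txPower m h) μ := hint (some (Sum.inl m))
    have h2 : Integrable (fun h => z.txPower m h) μ := by
      simpa [Pi.sub_def] using (integrable_const (P.powerLimit m)).sub h1
    simp only [slack]
    rw [integral_sub (integrable_const _) h2]
    simp
  have hinterf : ∀ k, μ (activeEvent M k) ≠ 0 →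
      ∫ h, slack P z h (some (Sum.inr (Sum.inl k))) ∂μ = μ.real (activeEvent M k) *
        (P.interfLimit k - ∫ h, z.interference k h ∂ProbabilityTheory.cond μ (activeEvent M k)) := by
    intro k hk
    have heq : ∀ h : CSI M K, slack P z h (some (Sum.inr (Sum.inl k))) =
        -(h.activity k * (z.interference k h - P.interfLimit k)) := fun h => by
      simp only [slack]
      ring
    have h1 := (hint (some (Sum.inr (Sum.inl k)))).neg
    simp only [heq, Pi.neg_def, neg_neg] at h1
    simp only [heq]
    rw [integral_neg, integral_activity_mul_sub hk h1]
    ring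
  have hrate : ∀ k, μ (activeEvent M k) ≠ 0 →
      ∫ h, slack P z h (some (Sum.inr (Sum.inr k))) ∂μ = μ.real (activeEvent M k) *
        (∫ h, z.primaryRate P k h ∂ProbabilityTheory.cond μ (activeEvent M k) - P.rateMin k) :=
    fun k hk => integral_activity_mul_sub hk (hint (some (Sum.inr (Sum.inr k))))
  have hpos : ∀ k, μ (activeEvent M k) ≠ 0 → 0 < μ.real (activeEvent M k) := fun k hk =>
    lt_of_le_of_ne measureReal_nonneg ((measureReal_ne_zero_iff (measure_ne_top _ _)).2 hk).symm
  constructor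
  · rintro ⟨h1, h2, h3⟩ (m | k | k)
    · rw [hpow]
      exact sub_nonneg.2 (h1 m)
    · by_cases hk : μ (activeEvent M k) = 0
      · exact (integral_activity_mul_of_null hk _).ge
      · rw [hinterf k hk]
        exact mul_nonneg (hpos k hk).le (sub_nonneg.2 (h2 k hk))
    · by_cases hk : μ (activeEvent M k) = 0
      · exact (integral_activity_mul_of_null hk _).ge
      · rw [hrate k hk]
        exact mul_nonneg (hpos k hk).le (sub_nonneg.2 (h3 k hk))
  · intro h
    refine ⟨fun m => ?_, fun k hk => ?_, fun k hk => ?_⟩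
    · have := h (Sum.inl m)
      rwa [hpow, sub_nonneg] at this
    · have := h (Sum.inr (Sum.inl k))
      rw [hinterf k hk] at this
      exact sub_nonneg.1 (nonneg_of_mul_nonneg_right this (hpos k hk))
    · have := h (Sum.inr (Sum.inr k))
      rw [hrate k hk] at this
      exact sub_nonneg.1 (nonneg_of_mul_nonneg_right this (hpos k hk))

theorem objective_eq {μ : Measure (CSI M K)} (hz : z.ShortTerm P)
    (hweight : ∀ m, 0 < P.weight m)
    (hpeak_rate : ∀ m k, Integrable
      (fun h : CSI M K => suRate (h.gainSU m k * P.peak m k h)) μ) :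
    z.objective P μ = ∫ h, slack P z h none ∂μ := by
  have hi := hz.integrable_utility hweight hpeak_rate
  simp only [objective, slack]
  rw [integral_finsetSum _ fun k _ => integrable_finsetSum _ fun m _ => hi m k]
  exact Finset.sum_congr rfl fun k _ => (integral_finsetSum _ fun m _ => hi m k).symm

theorem lagrangian_eq {μ : Measure (CSI M K)}
    (hint : ∀ i, Integrable (fun h => slack P z h i) μ) (l : Multipliers M K) :
    z.lagrangian P μ l = ∫ h, slack P z h none ∂μ +
      ∑ i, Sum.elim l.powerMul (Sum.elim l.interfMul l.rateMul) i *
        ∫ h, slack P z h (some i) ∂μ := by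
  simp only [← integral_const_mul]
  rw [← integral_finsetSum _ fun i _ => (hint (some i)).const_mul _,
    ← integral_add (hint none) (integrable_finsetSum _ fun i _ => (hint (some i)).const_mul _)]
  refine integral_congr_ae (Eventually.of_forall fun h => ?_)
  simp only [slack, Fintype.sum_sum_type, Sum.elim_inl, Sum.elim_inr]
  have h1 : ∑ m, l.powerMul m * (P.powerLimit m - z.txPower m h) =
      -∑ m, l.powerMul m * (z.txPower m h - P.powerLimit m) := by
    rw [← Finset.sum_neg_distrib]
    exact Finset.sum_congr rfl fun m _ => by ring
  have h2 : ∑ k, l.interfMul k * (h.activity k * (P.interfLimit k - z.interference k h)) =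
      -∑ k, l.interfMul k * (h.activity k * (z.interference k h - P.interfLimit k)) := by
    rw [← Finset.sum_neg_distrib]
    exact Finset.sum_congr rfl fun k _ => by ring
  rw [h1, h2]
  ring

end Policy

end CognitiveRadio

/-! ### Weak and strong duality -/

theorem mainTheorem1 {M K : ℕ} (P : CognitiveRadio.Params M K)
    (μ : Measure (CognitiveRadio.CSI M K)) [IsProbabilityMeasure μ] [NullSingletonClass μ]
    (hweight : ∀ m, 0 < P.weight m) (hsnr : ∀ k, 0 ≤ P.snr k)
    (hpeak_meas : ∀ m k, Measurable (P.peak m k))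
    (hpeak_nonneg : ∀ m k h, 0 ≤ P.peak m k h)
    (hpeak_power : ∀ m k, Integrable (P.peak m k) μ)
    (hpeak_interf : ∀ m k, Integrable
      (fun h : CognitiveRadio.CSI M K => h.activity k * (h.gainPU m k * P.peak m k h)) μ)
    (hpeak_rate : ∀ m k, Integrable
      (fun h : CognitiveRadio.CSI M K => CognitiveRadio.suRate (h.gainSU m k * P.peak m k h)) μ) :
    CognitiveRadio.primalValue P μ = CognitiveRadio.dualValue P μ := by
  have hS := CognitiveRadio.Policy.decomposable_slack (μ := μ) hweight hsnr hpeak_power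
    hpeak_interf hpeak_rate
  have hint : ∀ z : CognitiveRadio.Policy M K, z.ShortTerm P →
      ∀ i, Integrable (fun h => CognitiveRadio.Policy.slack P z h i) μ :=
    fun z hz => hS.integrable ⟨z, hz, rfl⟩
  refine le_antisymm ?_ ?_
  -- Weak duality: on a feasible policy the multiplier terms only add to the objective.
  · refine iSup₂_le fun z hz => le_iInf₂ fun l hl => ?_
    refine le_trans ?_ (le_iSup₂ (f := fun (z : CognitiveRadio.Policy M K) (_ : z.ShortTerm P) =>
      ((z.lagrangian P μ l : ℝ) : EReal)) z hz.1)
    have h := (CognitiveRadio.Policy.longTerm_iff (hint z hz.1)).1 hz.2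
    rw [EReal.coe_le_coe_iff, CognitiveRadio.Policy.objective_eq hz.1 hweight hpeak_rate,
      CognitiveRadio.Policy.lagrangian_eq (hint z hz.1)]
    refine le_add_of_nonneg_right (Finset.sum_nonneg fun i _ => mul_nonneg ?_ (h i))
    rcases i with m | k | k
    exacts [hl.1 m, hl.2.1 k, hl.2.2 k]
  · by_contra! hlt
    -- A real `r` strictly inside the supposed gap also covers primal value `⊥`; multipliers that
    -- bound the Lagrangian by `r` contradict `hr2`.
    obtain ⟨r, hr1, hr2⟩ := EReal.lt_iff_exists_real_btwn.1 hlt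
    obtain ⟨l, hl0, hl⟩ := CognitiveRadio.exists_multiplier hS.isCompact_integrals
      hS.convex_integrals (r := r) (by
        rintro _ ⟨_, ⟨z, hz, rfl⟩, rfl⟩ hfeas
        have hlong := (CognitiveRadio.Policy.longTerm_iff (hint z hz)).2 hfeas
        have h1 : ((z.objective P μ : ℝ) : EReal) < r := lt_of_le_of_lt
          (le_iSup₂ (f := fun (z : CognitiveRadio.Policy M K)
            (_ : z.ShortTerm P ∧ z.LongTerm P μ) => ((z.objective P μ : ℝ) : EReal)) z
            ⟨hz, hlong⟩) hr1
        rwa [EReal.coe_lt_coe_iff,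
          CognitiveRadio.Policy.objective_eq hz hweight hpeak_rate] at h1)
    set L : CognitiveRadio.Multipliers M K :=
      ⟨fun m => l (Sum.inl m), fun k => l (Sum.inr (Sum.inl k)),
        fun k => l (Sum.inr (Sum.inr k))⟩ with hL
    have hLl : Sum.elim L.powerMul (Sum.elim L.interfMul L.rateMul) = l := by
      funext i
      rcases i with m | k | k <;> rfl
    refine absurd hr2 (not_lt.2 (iInf₂_le_of_le L
      ⟨fun m => hl0 _, fun k => hl0 _, fun k => hl0 _⟩ (iSup₂_le fun z hz => ?_)))
    rw [EReal.coe_le_coe_iff, CognitiveRadio.Policy.lagrangian_eq (hint z hz), hLl]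
    exact hl _ ⟨_, ⟨z, hz, rfl⟩, rfl⟩
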